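/- Let $b$ be a prime, $s\ge 1$, $m\ge 0$, $p\in\mathbb{Z}_b[x]$ with $\deg p=m$, $\boldsymbol q=(q_1,\dots,q_s)\in\mathbb{Z}_b[x]^s$, $0<\alpha\le 1$, and let $\gamma_1,\dots,\gamma_s>0$; put $\gamma_{\mathfrak u}=\prod_{j\in\mathfrak u}\gamma_j$ for $\mathfrak u\subseteq[s]=\{1,\dots,s\}$. *Polynomial lattice rule.* For an integer $k\ge 0$ with base-$b$ digits $k=k_0+k_1b+\cdots$ let $\mathrm{tr}_m(k)(x)=k_0+k_1x+\cdots+k_{m-1}x^{m-1}\in\mathbb{Z}_b[x]$. For a formal Laurent series over $\mathbb Z_b$ in $x^{-1}$ let $v_m\big(\sum_{l\ge w}t_lx^{-l}\big)=\sum_{l=\max(1,w)}^m t_lb^{-l}$. The polynomial lattice rule with modulus $p$ and generating vector $\boldsymbol q$ uses the points $\boldsymbol x_h=\big(v_m(\mathrm{tr}_m(h)q_1/p),\dots,v_m(\mathrm{tr}_m(h)q_s/p)\big)\in[0,1)^s$, $0\le h<b^m$. Its dual polynomial lattice is $$\mathscr D_p(\boldsymbol q)=\{\boldsymbol k\in\mathbb{N}_0^s:\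 \mathrm{tr}_m(k_1)q_1+\dots+\mathrm{tr}_m(k_s)q_s\equiv 0 \pmod p\}.$$ *Owen scrambling.* Let $\pi_{j,\xi_1,\dots,\xi_{i}}$ ($1\le j\le s$, $i\ge 0$, $\xi_1,\dots,\xi_i\in\{0,\dots,b-1\}$) be independent, uniformly distributed random permutations of $\{0,\dots,b-1\}$. A point $\boldsymbol x\in[0,1)^s$ with $x_j=\sum_{i\ge1}\xi_{j,i}b^{-i}$ (for each $j$, infinitely many $\xi_{j,i}\ne b-1$) is sent to $\boldsymbol y$ with $y_j=\sum_{i\ge1}\eta_{j,i}b^{-i}$, $\eta_{j,i}=\pi_{j,\xi_{j,1},\dots,\xi_{j,i-1}}(\xi_{j,i})$. Let $\boldsymbol y_h$ be the image of $\boldsymbol x_h$, all under the same permutations, and $\hat I(f)=b^{-m}\sum_{h=0}^{b^m-1}f(\boldsymbol y_h)$. *Function space.* For $k=\sum_{i=0}^{a}k_ib^i$ and $x=\sum_{i\ge1}\xi_ib^{-i}\in[0,1)$ let $\mathrm{wal}_k(x)=\exp(2\pi\mathtt i(\xi_1k_0+\dots+\xi_{a+1}k_a)/b)$, and let $\mathrm{wal}_{\boldsymbol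 k}(\boldsymbol x)=\prod_{j}\mathrm{wal}_{k_j}(x_j)$ and $\hat f(\boldsymbol k)=\int_{[0,1]^s}f(\boldsymbol x)\overline{\mathrm{wal}_{\boldsymbol k}(\boldsymbol x)}\,d\boldsymbol x$. For $\mathfrak u\subseteq[s]$ and $\boldsymbol l_{\mathfrak u}\in\mathbb{N}^{|\mathfrak u|}$ (positive integers), let $|\boldsymbol l_{\mathfrak u}|_1=\sum_{i\in\mathfrak u}l_i$ and let $\sigma_{(\boldsymbol l_{\mathfrak u},\boldsymbol 0)}(f)\ge 0$ be given by $\sigma^2_{(\boldsymbol l_{\mathfrak u},\boldsymbol 0)}(f)=\sum_{\boldsymbol k}|\hat f(\boldsymbol k)|^2$, the sum being over all $\boldsymbol k\in\mathbb N_0^s$ with $b^{l_i-1}\le k_i<b^{l_i}$ for $i\in\mathfrak u$ and $k_i=0$ for $i\notin\mathfrak u$. Let $V_{\alpha,s,\boldsymbol\gamma}$ be the set of real-valued $f\in L_2([0,1]^s)$ with $$\|f\|_\alpha=\max_{\mathfrak u\subseteq[s]}\gamma_{\mathfrak u}^{-1/2}\sup_{\boldsymbol l_{\mathfrak u}\in\mathbb{N}^{|\mathfrak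 u|}}b^{\alpha|\boldsymbol l_{\mathfrak u}|_1}\sigma_{(\boldsymbol l_{\mathfrak u},\boldsymbol 0)}(f)<\infty .$$ *Bound.* Let $r_{2\alpha+1,\gamma}(0)=1$ and, for $k>0$ with exactly $a$ base-$b$ digits (i.e. $b^{a-1}\le k<b^a$), let $r_{2\alpha+1,\gamma}(k)=\gamma\,\frac{b}{(b-1)\,b^{(2\alpha+1)a}}$; let $r_{2\alpha+1,\boldsymbol\gamma}(\boldsymbol k)=\prod_{j=1}^s r_{2\alpha+1,\gamma_j}(k_j)$. Then the series $$B(\boldsymbol q,\alpha,\boldsymbol\gamma)=\sum_{\boldsymbol k\in\mathscr D_p(\boldsymbol q)\setminus\{\boldsymbol 0\}}r_{2\alpha+1,\boldsymbol\gamma}(\boldsymbol k)$$ converges, and $$\sup_{f\in V_{\alpha,s,\boldsymbol\gamma},\ \|f\|_\alpha\le1}\mathrm{Var}[\hat I(f)]\ \le\ B(\boldsymbol q,\alpha,\boldsymbol\gamma).$$ -/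

import Mathlib

open MeasureTheory ProbabilityTheory
open scoped ENNReal Polynomial

noncomputable section

namespace ScrambledPolyLattice

/-! ### Polynomial lattice point sets and their duals -/

/-- The `i`-th digit of the natural number `k` in base `b`. -/
def natDigit (b k i : ℕ) : ℕ := k / b ^ i % b

/-- The polynomial `k₀ + k₁ x + ⋯ + k_{m-1} x^{m-1}` over `ℤ_b` attached to the first `m` base-`b`
digits of `k`. For `k < b ^ m` it carries all the digits of `k`. -/
def truncPoly (b m k : ℕ) : (ZMod b)[X] :=
  ∑ i ∈ Finset.range m, Polynomial.monomial i (natDigit b k i : ZMod b)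

/-- The embedding of `ℤ_b[x]` into the field of formal Laurent series in `x⁻¹`. The variable of
Mathlib's `LaurentSeries` plays the role of `x⁻¹`, so that `x` is sent to its inverse and the
coefficient of `x^{-l}` of a series `L` is `L.coeff l`. -/
def toLaurent (b : ℕ) (g : (ZMod b)[X]) : LaurentSeries (ZMod b) :=
  Polynomial.aeval (HahnSeries.single (-1 : ℤ) (1 : ZMod b)) g

/-- The map `v_m`, `∑_{l ≥ w} t_l x^{-l} ↦ ∑_{l = max(1, w)}^{m} t_l b^{-l}`. -/
def vmap (b m : ℕ) (L : LaurentSeries (ZMod b)) : ℝ :=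
  ∑ l ∈ Finset.Icc 1 m, ((L.coeff (l : ℤ)).val : ℝ) / (b : ℝ) ^ l

/-- The `h`-th point `x_h`, `0 ≤ h < b ^ m`, of the polynomial lattice point set with modulus `p` of
degree `m` and generating vector `q`. -/
def latticePoint {b s : ℕ} [Fact b.Prime] (m : ℕ) (p : (ZMod b)[X]) (q : Fin s → (ZMod b)[X])
    (h : ℕ) : Fin s → ℝ :=
  fun j => vmap b m (toLaurent b (truncPoly b m h * q j) / toLaurent b p)

/-- The dual polynomial lattice. -/
def dualLattice {b s : ℕ} (m : ℕ) (p : (ZMod b)[X]) (q : Fin s → (ZMod b)[X]) :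
    Set (Fin s → ℕ) :=
  {k | p ∣ ∑ j, truncPoly b m (k j) * q j}

/-! ### Owen scrambling -/

/-- A family of independent, uniformly distributed random permutations of `{0, …, b - 1}`, indexed by
a coordinate `j` and a finite sequence of digits. -/
structure IsScrambling {Ω : Type*} [MeasurableSpace Ω] (μ : Measure Ω) {b s : ℕ}
    (perm : Fin s → List (Fin b) → Ω → Equiv.Perm (Fin b)) : Prop where
  measurableSet : ∀ j l σ, MeasurableSet {ω | perm j l ω = σ}
  uniform : ∀ j l σ, μ {ω | perm j l ω = σ} = (b.factorial : ℝ≥0∞)⁻¹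
  indep : iIndepFun (m := fun _ => ⊤) (fun i : Fin s × List (Fin b) => perm i.1 i.2) μ

/-- The scrambling of a digit sequence (`ξ i` is the digit belonging to `b ^ (-(i + 1))`): the
permutation applied to the digit `ξ i` depends on the preceding digits `ξ 0, …, ξ (i - 1)`. -/
def scrambleDigits {b : ℕ} (perm : List (Fin b) → Equiv.Perm (Fin b)) (ξ : ℕ → Fin b) :
    ℕ → Fin b :=
  fun i => perm ((List.range i).map ξ) (ξ i)

/-- The scrambled point `y` obtained from a point `x ∈ [0, 1)^s`. -/
def scramblePoint {b s : ℕ} [NeZero b] (perm : Fin s → List (Fin b) → Equiv.Perm (Fin b))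
    (x : Fin s → ℝ) : Fin s → ℝ :=
  fun j => Real.ofDigits (scrambleDigits (perm j) (Real.digits (x j) b))

/-- The estimator `(1 / N) ∑_{h < N} f(y_h)`, with `y_h` the scrambled version of `x_h`; all points are
scrambled with the same random permutations. -/
def estimator {Ω : Type*} {b s : ℕ} [NeZero b]
    (perm : Fin s → List (Fin b) → Ω → Equiv.Perm (Fin b)) (N : ℕ) (x : ℕ → Fin s → ℝ)
    (f : (Fin s → ℝ) → ℝ) (ω : Ω) : ℝ :=
  (1 / (N : ℝ)) * ∑ h ∈ Finset.range N, f (scramblePoint (fun j l => perm j l ω) (x h))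

/-! ### The weighted function space -/

/-- Lebesgue measure on the unit cube `[0, 1]^s`. -/
def cubeMeasure (s : ℕ) : Measure (Fin s → ℝ) := volume.restrict (Set.Icc 0 1)

/-- The `k`-th Walsh function in base `b`. -/
def wal (b : ℕ) [NeZero b] (k : ℕ) (x : ℝ) : ℂ :=
  Complex.exp (2 * Real.pi * Complex.I *
    (∑ i ∈ Finset.range (Nat.digits b k).length,
      (((Real.digits x b i : ℕ) * natDigit b k i : ℕ) : ℂ)) / b)

/-- The multivariate Walsh function. -/
def walVec (b : ℕ) [NeZero b] {s : ℕ} (k : Fin s → ℕ) (x : Fin s → ℝ) : ℂ :=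
  ∏ j, wal b (k j) (x j)

/-- The Walsh coefficient of `f` at `k`. -/
def walshCoeff (b : ℕ) [NeZero b] {s : ℕ} (f : (Fin s → ℝ) → ℝ) (k : Fin s → ℕ) : ℂ :=
  ∫ x, (f x : ℂ) * (starRingEnd ℂ) (walVec b k x) ∂(cubeMeasure s)

/-- The set of all `k` with `b ^ (l i - 1) ≤ k i < b ^ (l i)` for `i ∈ u` and `k i = 0` for `i ∉ u`.
Only the values of `l` on `u` matter. -/
def levelSet (b : ℕ) {s : ℕ} (u : Finset (Fin s)) (l : Fin s → ℕ) : Finset (Fin s → ℕ) :=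
  Fintype.piFinset fun i => if i ∈ u then Finset.Ico (b ^ (l i - 1)) (b ^ l i) else {0}

/-- `σ_{(l_u, 0)}(f)`, the square root of the sum of `|f̂(k)|²` over `k` in the level set. -/
def sigma (b : ℕ) [NeZero b] {s : ℕ} (f : (Fin s → ℝ) → ℝ) (u : Finset (Fin s))
    (l : Fin s → ℕ) : ℝ :=
  √(∑ k ∈ levelSet b u l, ‖walshCoeff b f k‖ ^ 2)

/-- The weighted norm `max_u γ_u^{-1/2} sup_{l_u} b^{α |l_u|₁} σ_{(l_u, 0)}(f)`, with values in
`[0, ∞]`; the inner supremum is over positive integers `l i`, `i ∈ u`. -/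
def weightedNorm (b : ℕ) [NeZero b] {s : ℕ} (α : ℝ) (γ : Fin s → ℝ) (f : (Fin s → ℝ) → ℝ) :
    ℝ≥0∞ :=
  ⨆ u : Finset (Fin s), ⨆ l : Fin s → ℕ, ⨆ _ : ∀ i ∈ u, 1 ≤ l i,
    ENNReal.ofReal ((∏ j ∈ u, γ j) ^ (-(1 / 2) : ℝ) *
      ((b : ℝ) ^ (α * ((∑ i ∈ u, l i : ℕ) : ℝ)) * sigma b f u l))

/-- The space `V_{α,s,γ}` of square-integrable functions on the unit cube of finite norm. -/
def V (b : ℕ) [NeZero b] {s : ℕ} (α : ℝ) (γ : Fin s → ℝ) : Set ((Fin s → ℝ) → ℝ) :=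
  {f | MemLp f 2 (cubeMeasure s) ∧ weightedNorm b α γ f < ∞}

/-! ### The worst-case variance and the bound -/

/-- The worst-case variance over the unit ball of `V_{α,s,γ}` of the estimator that scrambles the
points `x 0, …, x (N - 1)` with the random permutations `perm`. -/
def worstCaseVariance {Ω : Type*} [MeasurableSpace Ω] (μ : Measure Ω) {b s : ℕ} [NeZero b]
    (perm : Fin s → List (Fin b) → Ω → Equiv.Perm (Fin b)) (N : ℕ) (x : ℕ → Fin s → ℝ)
    (α : ℝ) (γ : Fin s → ℝ) : ℝ≥0∞ :=
  ⨆ f ∈ V b α γ, ⨆ _ : weightedNorm b α γ f ≤ 1, evariance (estimator perm N x f) μ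

/-- `r_{α,γ}(k)`: `1` for `k = 0`, and `γ b / ((b - 1) b^{α a})` if `k` has `a ≥ 1` digits. -/
def r (b : ℕ) (α γ : ℝ) (k : ℕ) : ℝ :=
  if k = 0 then 1
  else γ * ((b : ℝ) / (((b : ℝ) - 1) * (b : ℝ) ^ (α * ((Nat.digits b k).length : ℝ))))

/-- `r_{α,γ}(k)` for a vector `k`. -/
def rVec (b : ℕ) {s : ℕ} (α : ℝ) (γ : Fin s → ℝ) (k : Fin s → ℕ) : ℝ :=
  ∏ j, r b α (γ j) (k j)

end ScrambledPolyLattice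

end

/-!
The scrambled points depend on `f` only through the digits of its arguments, so everything happens on
the space of digit sequences, with the distribution `digitMeasure` of the digits of a uniform point.
There the Walsh functions form an orthonormal basis of `L²` (`IsScrambling.orthonormal_walLp`,
`orthogonal_span_walLp`): the indicator function of a cylinder is a finite sum of Walsh functions
(`indicator_cyl`), and cylinders generate the `σ`-algebra.

A Walsh function of a scrambled point is a product, over the nodes of the trees of digit sequences,
of characters of the independent permutations sitting at these nodes. Therefore
`E[wal_k(y) conj(wal_k'(y'))]` vanishes for `k ≠ k'`, and for `k = k'` it depends only on the numbers
of digits of the coordinates of `k`: it is the average of `wal_κ(x) conj(wal_κ(x'))` over all `κ` in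
the level of `k`, that is, with the same numbers of digits (`IsScrambling.integral_seqWalVec`,
`prod_levelKernel`). Consequently the images of the Walsh functions under the operator
`scrambleMean`, which maps `f` to the estimator, are orthogonal, and the squared norm of the image of
`wal_k` is the average over the level of `k` of the squared errors `|N⁻¹ ∑ wal_κ(x_h)|²`. For a
polynomial lattice these are `0` for `κ` outside the dual lattice
(`sum_seqWalVec_latticePoint`) and at most `1` otherwise. So the variance is at most the sum over the
nonzero levels of `σ²` times the proportion of dual lattice elements in the level. On the unit ball
`σ²` is bounded by the value of `r` on the level times the size of the level
(`sum_walshCoeff_sq_le`), and the sum over the levels becomes the sum of `r` over the dual lattice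
(`sum_le_tsum_dual`).
-/

open MeasureTheory ProbabilityTheory
open scoped ENNReal Polynomial

noncomputable section

namespace ScrambledPolyLattice

/-! ### Walsh functions of digit sequences -/

/-- The residue class modulo `b` of a base-`b` digit. -/
def digitRes {b : ℕ} (x : Fin b) : ZMod b := ((x : ℕ) : ZMod b)

lemma digitRes_injective {b : ℕ} : Function.Injective (digitRes (b := b)) := by
  intro x y h
  rw [digitRes, digitRes, ZMod.natCast_eq_natCast_iff', Nat.mod_eq_of_lt x.2,
    Nat.mod_eq_of_lt y.2] at h
  exact Fin.ext h

lemma digitRes_bijective {b : ℕ} [NeZero b] : Function.Bijective (digitRes (b := b)) :=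
  (Fintype.bijective_iff_injective_and_card _).2 ⟨digitRes_injective, by simp [ZMod.card]⟩

@[simp] lemma digitRes_ofNat {b : ℕ} [NeZero b] (n : ℕ) : digitRes (Fin.ofNat b n) = n := by
  simp [digitRes]

/-- The primitive additive character `t ↦ exp (2 π i t / b)` of `ℤ / b`. -/
abbrev chi {b : ℕ} [NeZero b] : AddChar (ZMod b) ℂ := ZMod.stdAddChar

lemma natDigit_eq_zero {b k i : ℕ} (h : k < b ^ i) : natDigit b k i = 0 := by
  simp [natDigit, Nat.div_eq_of_lt h]

lemma length_digits_eq_zero {b k : ℕ} : (Nat.digits b k).length = 0 ↔ k = 0 := by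
  rw [List.length_eq_zero_iff, Nat.digits_eq_nil_iff_eq_zero]

section
variable {b : ℕ} [NeZero b]

lemma norm_chi (t : ZMod b) : ‖chi t‖ = 1 := AddChar.norm_apply _ _

lemma conj_chi (t : ZMod b) : (starRingEnd ℂ) (chi t) = chi (-t) :=
  (AddChar.map_neg_eq_conj _ _).symm

lemma chi_ne_one {t : ZMod b} (ht : t ≠ 0) : chi t ≠ 1 := fun h =>
  ht (ZMod.injective_stdAddChar (h.trans (AddChar.map_zero_eq_one _).symm))

lemma chi_sum {ι : Type*} (S : Finset ι) (f : ι → ZMod b) :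
    chi (∑ i ∈ S, f i) = ∏ i ∈ S, chi (f i) := by
  classical
  induction S using Finset.induction_on with
  | empty => simp
  | insert a S ha ih => rw [Finset.sum_insert ha, Finset.prod_insert ha, AddChar.map_add_eq_mul, ih]

lemma sum_chi_mul (t : ZMod b) : ∑ x : Fin b, chi (digitRes x * t) = if t = 0 then (b : ℂ) else 0 := by
  rw [digitRes_bijective.sum_comp (fun x => chi (x * t)),
    AddChar.sum_mulShift t (ZMod.isPrimitive_stdAddChar b), ZMod.card]
  simp

/-- The `k`-th Walsh function as a function of the digit sequence of its argument. -/
def seqWal (k : ℕ) (ξ : ℕ → Fin b) : ℂ :=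
  ∏ i ∈ Finset.range (Nat.digits b k).length, chi ((natDigit b k i : ZMod b) * digitRes (ξ i))

lemma natDigit_lt (k i : ℕ) : natDigit b k i < b := Nat.mod_lt _ (NeZero.pos b)

lemma natDigit_cast_eq_zero {k i : ℕ} : (natDigit b k i : ZMod b) = 0 ↔ natDigit b k i = 0 := by
  rw [ZMod.natCast_eq_zero_iff]
  exact ⟨fun h => Nat.eq_zero_of_dvd_of_lt h (natDigit_lt k i), fun h => h ▸ dvd_zero _⟩

lemma natDigit_cast_inj {k k' i : ℕ} :
    (natDigit b k i : ZMod b) = natDigit b k' i ↔ natDigit b k i = natDigit b k' i := by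
  rw [ZMod.natCast_eq_natCast_iff', Nat.mod_eq_of_lt (natDigit_lt _ _),
    Nat.mod_eq_of_lt (natDigit_lt _ _)]

end

section
variable {b : ℕ} [Fact b.Prime]

lemma one_lt_base : 1 < b := (Fact.out : b.Prime).one_lt

lemma lt_pow_digits_length (k : ℕ) : k < b ^ (Nat.digits b k).length :=
  Nat.lt_base_pow_length_digits one_lt_base

lemma natDigit_eq_zero_of_length_le {k i : ℕ} (h : (Nat.digits b k).length ≤ i) :
    natDigit b k i = 0 :=
  natDigit_eq_zero ((lt_pow_digits_length k).trans_le
    (Nat.pow_le_pow_right (NeZero.pos b) h))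

lemma eq_of_natDigit_eq {k k' : ℕ} (h : ∀ i, natDigit b k i = natDigit b k' i) : k = k' := by
  have key : ∀ n k k' : ℕ, k < b ^ n → k' < b ^ n → (∀ i, natDigit b k i = natDigit b k' i) →
      k = k' := by
    intro n k k' hk hk' h
    have := (finFunctionFinEquiv (m := b) (n := n)).symm.injective
      (a₁ := ⟨k, hk⟩) (a₂ := ⟨k', hk'⟩) (by
        funext i
        exact Fin.ext (h i))
    exact congrArg Fin.val this
  refine key (max (Nat.digits b k).length (Nat.digits b k').length) k k' ?_ ?_ h
  · exact (lt_pow_digits_length k).trans_le (Nat.pow_le_pow_right (NeZero.pos b) (le_max_left _ _))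
  · exact (lt_pow_digits_length k').trans_le
      (Nat.pow_le_pow_right (NeZero.pos b) (le_max_right _ _))

lemma seqWal_eq_prod_range {k n : ℕ} (h : k < b ^ n) (ξ : ℕ → Fin b) :
    seqWal k ξ = ∏ i ∈ Finset.range n, chi ((natDigit b k i : ZMod b) * digitRes (ξ i)) := by
  refine Finset.prod_subset ?_ ?_
  · exact Finset.range_mono ((Nat.digits_length_le_iff one_lt_base k).2 h)
  · intro i _ hi
    rw [natDigit_eq_zero_of_length_le (by simpa using hi)]
    simp

lemma norm_seqWal (k : ℕ) (ξ : ℕ → Fin b) : ‖seqWal k ξ‖ = 1 := by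
  simp only [seqWal, norm_prod, norm_chi, Finset.prod_const_one]

@[simp] lemma seqWal_zero (ξ : ℕ → Fin b) : seqWal 0 ξ = 1 := by simp [seqWal]

lemma wal_eq_seqWal (k : ℕ) (x : ℝ) : wal b k x = seqWal k (Real.digits x b) := by
  rw [wal, seqWal, ← chi_sum]
  have : ∑ i ∈ Finset.range (Nat.digits b k).length,
      (natDigit b k i : ZMod b) * digitRes (Real.digits x b i) =
      ((∑ i ∈ Finset.range (Nat.digits b k).length,
        (Real.digits x b i : ℕ) * natDigit b k i : ℕ) : ℤ) := by
    push_cast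
    exact Finset.sum_congr rfl fun i _ => by rw [digitRes, mul_comm]
  rw [this, ZMod.stdAddChar_coe]
  push_cast
  rfl

lemma seqWal_mul_conj {k n : ℕ} (h : k < b ^ n) (ξ ξ' : ℕ → Fin b) :
    seqWal k ξ * (starRingEnd ℂ) (seqWal k ξ') =
      ∏ i ∈ Finset.range n, chi ((natDigit b k i : ZMod b) * (digitRes (ξ i) - digitRes (ξ' i))) := by
  rw [seqWal_eq_prod_range h, seqWal_eq_prod_range h, map_prod, ← Finset.prod_mul_distrib]
  refine Finset.prod_congr rfl fun i _ => ?_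
  rw [conj_chi, ← AddChar.map_add_eq_mul]
  congr 1
  ring

/-- The Dirichlet kernel of the Walsh system: summing a character over all `k < b ^ n` factors into
complete character sums over the single digits of `k`. -/
lemma sum_prod_chi (n : ℕ) (t : ℕ → ZMod b) :
    ∑ k ∈ Finset.range (b ^ n), ∏ i ∈ Finset.range n, chi ((natDigit b k i : ZMod b) * t i) =
      if ∀ i < n, t i = 0 then (b : ℂ) ^ n else 0 := by
  have h1 : ∑ k ∈ Finset.range (b ^ n), ∏ i ∈ Finset.range n,
      chi ((natDigit b k i : ZMod b) * t i) =
      ∑ f : Fin n → Fin b, ∏ i : Fin n, chi (digitRes (f i) * t i) := by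
    rw [Finset.sum_range, ← finFunctionFinEquiv.symm.sum_comp]
    refine Finset.sum_congr rfl fun k _ => ?_
    rw [Finset.prod_range]
    rfl
  rw [h1, ← Fintype.piFinset_univ, ← Finset.prod_univ_sum (fun _ : Fin n => Finset.univ)
    (fun i x => chi (digitRes x * t i))]
  simp_rw [sum_chi_mul]
  split_ifs with h
  · simp [h]
  · push Not at h
    obtain ⟨i, hi, hne⟩ := h
    exact Finset.prod_eq_zero (Finset.mem_univ ⟨i, hi⟩) (by simp [hne])

lemma sum_seqWal_mul_conj (n : ℕ) (ξ ξ' : ℕ → Fin b) :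
    ∑ k ∈ Finset.range (b ^ n), seqWal k ξ * (starRingEnd ℂ) (seqWal k ξ') =
      if ∀ i < n, ξ i = ξ' i then (b : ℂ) ^ n else 0 := by
  rw [Finset.sum_congr rfl fun k hk => seqWal_mul_conj (Finset.mem_range.1 hk) ξ ξ',
    sum_prod_chi n fun i => digitRes (ξ i) - digitRes (ξ' i)]
  simp only [sub_eq_zero, digitRes_injective.eq_iff]

/-- The natural numbers with as many base-`b` digits as `k`. -/
def level (b k : ℕ) : Finset ℕ :=
  if k = 0 then {0} else
    Finset.Ico (b ^ ((Nat.digits b k).length - 1)) (b ^ (Nat.digits b k).length)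

lemma mem_level {k κ : ℕ} :
    κ ∈ level b k ↔ (Nat.digits b κ).length = (Nat.digits b k).length := by
  unfold level
  split_ifs with h
  · subst h
    simp [Nat.digits_eq_nil_iff_eq_zero]
  · have hpos : 0 < (Nat.digits b k).length := by
      simpa [List.length_pos_iff, Nat.digits_ne_nil_iff_ne_zero] using h
    rw [Finset.mem_Ico, ← Nat.digits_length_le_iff one_lt_base,
      ← Nat.lt_digits_length_iff one_lt_base]
    omega

/-- The average of `wal_κ(x)` times the conjugate of `wal_κ(y)` over all `κ` with as many digits as
`k`. -/
def levelKernel (k : ℕ) (ξ ξ' : ℕ → Fin b) : ℂ :=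
  ((level b k).card : ℂ)⁻¹ * ∑ κ ∈ level b k, seqWal κ ξ * (starRingEnd ℂ) (seqWal κ ξ')

lemma levelKernel_zero (ξ ξ' : ℕ → Fin b) : levelKernel 0 ξ ξ' = 1 := by
  simp [levelKernel, level]

/-- The kernel depends only on the position of the first digit at which the points differ. -/
lemma levelKernel_eq {k l : ℕ} (hl : (Nat.digits b k).length = l + 1) (ξ ξ' : ℕ → Fin b) :
    levelKernel k ξ ξ' =
      if ∀ i < l, ξ i = ξ' i then (if ξ l = ξ' l then 1 else -((b : ℂ) - 1)⁻¹) else 0 := by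
  have hk : k ≠ 0 := by rintro rfl; simp at hl
  have hb : (b : ℂ) - 1 ≠ 0 := by
    rw [sub_ne_zero]
    exact_mod_cast (one_lt_base (b := b)).ne'
  have hb0 : (b : ℂ) ^ l ≠ 0 := pow_ne_zero _ (NeZero.ne _)
  have hle : b ^ l ≤ b ^ (l + 1) := Nat.pow_le_pow_right (NeZero.pos b) (Nat.le_succ l)
  have hlev : level b k = Finset.Ico (b ^ l) (b ^ (l + 1)) := by
    simp [level, hk, hl]
  rw [levelKernel, hlev, Finset.sum_Ico_eq_sub _ hle, sum_seqWal_mul_conj, sum_seqWal_mul_conj,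
    Nat.card_Ico, Nat.cast_sub hle]
  have hiff : (∀ i < l + 1, ξ i = ξ' i) ↔ (∀ i < l, ξ i = ξ' i) ∧ ξ l = ξ' l :=
    Nat.forall_lt_succ_right
  push_cast
  have hfac : (b : ℂ) ^ (l + 1) - b ^ l = b ^ l * (b - 1) := by ring
  by_cases h1 : ∀ i < l, ξ i = ξ' i <;> by_cases h2 : ξ l = ξ' l
  · rw [if_pos (hiff.2 ⟨h1, h2⟩), if_pos h1, if_pos h1, if_pos h2, hfac]
    exact inv_mul_cancel₀ (mul_ne_zero hb0 hb)
  · rw [if_neg (fun h => h2 (hiff.1 h).2), if_pos h1, if_pos h1, if_neg h2, hfac]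
    field_simp
    ring
  · rw [if_neg (fun h => h1 (hiff.1 h).1), if_neg h1, if_neg h1]
    simp
  · rw [if_neg (fun h => h1 (hiff.1 h).1), if_neg h1, if_neg h1]
    simp

/-! ### Averages of characters over a uniform permutation -/

/-- The expectation of `χ(a σ(x)) χ(-a' σ(x'))` for a uniformly distributed permutation `σ` of the
digits. -/
def permAvg (a a' : ZMod b) (x x' : Fin b) : ℂ :=
  ((b.factorial : ℂ))⁻¹ * ∑ σ : Equiv.Perm (Fin b),
    chi (a * digitRes (σ x)) * (starRingEnd ℂ) (chi (a' * digitRes (σ x')))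

lemma digitRes_add (x y : Fin b) : digitRes (x + y) = digitRes x + digitRes y := by
  simp [digitRes, Fin.val_add]

/-- Replacing `σ` by `σ + 1` multiplies the average by `χ(a - a')`. -/
lemma permAvg_of_ne {a a' : ZMod b} (h : a ≠ a') (x x' : Fin b) : permAvg a a' x x' = 0 := by
  have h1 : ∑ σ : Equiv.Perm (Fin b),
      chi (a * digitRes (σ x)) * (starRingEnd ℂ) (chi (a' * digitRes (σ x'))) =
      chi (a - a') * ∑ σ : Equiv.Perm (Fin b),
      chi (a * digitRes (σ x)) * (starRingEnd ℂ) (chi (a' * digitRes (σ x'))) := by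
    conv_lhs => rw [← Equiv.sum_comp (Equiv.mulLeft (Equiv.addRight (1 : Fin b)))]
    rw [Finset.mul_sum]
    refine Finset.sum_congr rfl fun σ _ => ?_
    have hone : digitRes (1 : Fin b) = 1 := by
      have : Fact (1 < b) := ⟨one_lt_base⟩
      simp [digitRes, Nat.mod_eq_of_lt (one_lt_base (b := b))]
    simp only [Equiv.coe_mulLeft, Equiv.Perm.mul_apply, Equiv.coe_addRight, digitRes_add, hone,
      conj_chi]
    rw [← AddChar.map_add_eq_mul, ← AddChar.map_add_eq_mul, ← AddChar.map_add_eq_mul]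
    congr 1
    ring
  have h2 : (chi (a - a') - 1) * ∑ σ : Equiv.Perm (Fin b),
      chi (a * digitRes (σ x)) * (starRingEnd ℂ) (chi (a' * digitRes (σ x'))) = 0 := by
    rw [sub_mul, one_mul, ← h1, sub_self]
  rw [permAvg, (mul_eq_zero.1 h2).resolve_left (sub_ne_zero.2 (chi_ne_one (sub_ne_zero.2 h))),
    mul_zero]

lemma permAvg_zero (x x' : Fin b) : permAvg (0 : ZMod b) 0 x x' = 1 := by
  simp [permAvg, Fintype.card_perm, Nat.factorial_ne_zero]

lemma permAvg_self (a : ZMod b) (x : Fin b) : permAvg a a x x = 1 := by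
  simp only [permAvg, Complex.mul_conj, Complex.normSq_eq_norm_sq, norm_chi]
  simp [Fintype.card_perm, Nat.factorial_ne_zero]

/-- The averages for the pairs `x ≠ x'` coincide by symmetry, and together with the diagonal term
they add up to a complete character sum. -/
lemma permAvg_of_ne_digit {a : ZMod b} (ha : a ≠ 0) {x x' : Fin b} (h : x ≠ x') :
    permAvg a a x x' = -((b : ℂ) - 1)⁻¹ := by
  have hb : (b : ℂ) - 1 ≠ 0 := by
    rw [sub_ne_zero]
    exact_mod_cast (one_lt_base (b := b)).ne'
  have hsymm : ∀ y, x ≠ y → permAvg a a x y = permAvg a a x x' := by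
    intro y hy
    rw [permAvg, permAvg, ← Equiv.sum_comp (Equiv.mulRight (Equiv.swap x' y))]
    congr 1
    refine Finset.sum_congr rfl fun σ _ => ?_
    simp [Equiv.Perm.mul_apply, Equiv.swap_apply_of_ne_of_ne h hy]
  have hsum : ∑ y, permAvg a a x y = 0 := by
    simp only [permAvg]
    rw [← Finset.mul_sum, Finset.sum_comm]
    refine mul_eq_zero_of_right _ (Finset.sum_eq_zero fun σ _ => ?_)
    rw [← Finset.mul_sum, ← map_sum, Equiv.sum_comp σ (fun y => chi (a * digitRes y))]
    simp_rw [mul_comm a]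
    rw [sum_chi_mul, if_neg ha]
    simp
  rw [← Finset.add_sum_erase _ _ (Finset.mem_univ x), permAvg_self,
    Finset.sum_congr rfl (fun y hy => hsymm y (Finset.ne_of_mem_erase hy).symm),
    Finset.sum_const, Finset.card_erase_of_mem (Finset.mem_univ x), Finset.card_univ,
    Fintype.card_fin, nsmul_eq_mul, Nat.cast_sub one_lt_base.le, Nat.cast_one] at hsum
  field_simp
  linear_combination hsum

end

/-! ### Mixed moments of scrambled Walsh functions -/

lemma map_range_inj {b : ℕ} {ξ ξ' : ℕ → Fin b} {i : ℕ} :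
    (List.range i).map ξ = (List.range i).map ξ' ↔ ∀ d < i, ξ d = ξ' d := by
  simp

lemma IsScrambling.measurable {b s : ℕ} {Ω : Type*} [MeasurableSpace Ω] {μ : Measure Ω}
    {perm : Fin s → List (Fin b) → Ω → Equiv.Perm (Fin b)} (hperm : IsScrambling μ perm)
    (j : Fin s) (l : List (Fin b)) :
    Measurable[_, ⊤] (perm j l) := by
  let _ : MeasurableSpace (Equiv.Perm (Fin b)) := ⊤
  exact measurable_to_countable' fun σ => hperm.measurableSet j l σ

section
variable {b : ℕ} [Fact b.Prime]

/-- The `i`-th digit of `k` if `v` consists of the first `i` digits of `ξ`, and `0` for all other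
finite digit sequences `v`. This is the frequency with which the permutation at the node `v` of the
tree of digit sequences enters the `k`-th Walsh function of the scrambling of `ξ`. -/
def nodeDigit (k : ℕ) (ξ : ℕ → Fin b) (v : List (Fin b)) : ZMod b :=
  if v = (List.range v.length).map ξ then (natDigit b k v.length : ZMod b) else 0

lemma nodeDigit_prefix (k : ℕ) (ξ : ℕ → Fin b) (i : ℕ) :
    nodeDigit k ξ ((List.range i).map ξ) = natDigit b k i := by
  simp [nodeDigit]

/-- A Walsh function of a scrambled point as a product over a set of nodes that contains the path of the
point; nodes off the path contribute the factor `1`. -/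
lemma seqWal_scrambleDigits {k n : ℕ} (hk : k < b ^ n) (ξ : ℕ → Fin b) (T : Finset (List (Fin b)))
    (hT : ∀ i < n, (List.range i).map ξ ∈ T) (π : List (Fin b) → Equiv.Perm (Fin b)) :
    seqWal k (scrambleDigits π ξ) =
      ∏ v ∈ T, chi (nodeDigit k ξ v * digitRes (π v (ξ v.length))) := by
  classical
  have himg : (Finset.range n).image (fun i => (List.range i).map ξ) ⊆ T := by
    intro v hv
    obtain ⟨i, hi, rfl⟩ := Finset.mem_image.1 hv
    exact hT i (Finset.mem_range.1 hi)
  rw [seqWal_eq_prod_range hk, ← Finset.prod_subset himg, Finset.prod_image]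
  · refine Finset.prod_congr rfl fun i _ => ?_
    rw [nodeDigit_prefix]
    simp [scrambleDigits]
  · intro i _ j _ hij
    simpa using congrArg List.length hij
  · intro v _ hv
    have : nodeDigit k ξ v = 0 := by
      unfold nodeDigit
      split_ifs with h
      · have hn : n ≤ v.length := by
          by_contra hlt
          exact hv (Finset.mem_image.2 ⟨v.length, by simpa using hlt, h.symm⟩)
        rw [natDigit_eq_zero (hk.trans_le (Nat.pow_le_pow_right (NeZero.pos b) hn)), Nat.cast_zero]
      · rfl
    simp [this]

lemma natDigit_top_ne_zero {k l : ℕ} (hl : (Nat.digits b k).length = l + 1) :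
    natDigit b k l ≠ 0 := by
  have h1 : b ^ l ≤ k := by
    rw [← Nat.lt_digits_length_iff one_lt_base]
    omega
  have h2 : k < b ^ (l + 1) := hl ▸ lt_pow_digits_length k
  rw [natDigit, Nat.mod_eq_of_lt (Nat.div_lt_of_lt_mul (by rwa [← pow_succ]))]
  exact (Nat.div_pos h1 (pow_pos (NeZero.pos b) l)).ne'

/-- Distinct frequencies `k` and `k'` differ in some digit, and the node at which the differing digit is
read has mean zero: either both paths pass through it with different frequencies, or one path passes
alone with a nonzero frequency. -/
lemma prod_permAvg_of_ne {k k' n : ℕ} (hk : k < b ^ n) (hk' : k' < b ^ n) (ξ ξ' : ℕ → Fin b)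
    (T : Finset (List (Fin b))) (hT : ∀ i < n, (List.range i).map ξ ∈ T)
    (hT' : ∀ i < n, (List.range i).map ξ' ∈ T) (hne : k ≠ k') :
    ∏ v ∈ T, permAvg (nodeDigit k ξ v) (nodeDigit k' ξ' v) (ξ v.length) (ξ' v.length) = 0 := by
  obtain ⟨i, hi⟩ : ∃ i, natDigit b k i ≠ natDigit b k' i := by
    by_contra! h
    exact hne (eq_of_natDigit_eq h)
  have hin : i < n := by
    by_contra! hni
    have := Nat.pow_le_pow_right (NeZero.pos b) hni
    exact hi (by rw [natDigit_eq_zero (hk.trans_le this), natDigit_eq_zero (hk'.trans_le this)])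
  by_cases hag : (List.range i).map ξ = (List.range i).map ξ'
  · refine Finset.prod_eq_zero (hT i hin) (permAvg_of_ne ?_ _ _)
    rw [nodeDigit_prefix, hag, nodeDigit_prefix, ne_eq, natDigit_cast_inj]
    exact hi
  · by_cases h0 : natDigit b k i = 0
    · refine Finset.prod_eq_zero (hT' i hin) (permAvg_of_ne ?_ _ _)
      rw [nodeDigit_prefix, nodeDigit, if_neg (by rw [List.length_map, List.length_range]; exact fun h => hag h.symm),
        ne_comm, ne_eq, natDigit_cast_eq_zero]
      exact fun h => hi (h0.trans h.symm)
    · refine Finset.prod_eq_zero (hT i hin) (permAvg_of_ne ?_ _ _)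
      rw [nodeDigit_prefix, nodeDigit, if_neg (by simpa using hag), ne_eq, natDigit_cast_eq_zero]
      exact h0

lemma prod_permAvg_self {k n : ℕ} (hk : k < b ^ n) (ξ ξ' : ℕ → Fin b)
    (T : Finset (List (Fin b))) (hT : ∀ i < n, (List.range i).map ξ ∈ T) :
    ∏ v ∈ T, permAvg (nodeDigit k ξ v) (nodeDigit k ξ' v) (ξ v.length) (ξ' v.length) =
      levelKernel k ξ ξ' := by
  rcases Nat.eq_zero_or_pos k with rfl | hpos
  · rw [levelKernel_zero]
    refine Finset.prod_eq_one fun v _ => ?_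
    simp [nodeDigit, natDigit, permAvg_zero]
  · obtain ⟨l, hl⟩ : ∃ l, (Nat.digits b k).length = l + 1 := by
      refine Nat.exists_eq_succ_of_ne_zero ?_
      simpa [Nat.digits_eq_nil_iff_eq_zero] using hpos.ne'
    have hln : l < n := by
      have := (Nat.digits_length_le_iff (one_lt_base (b := b)) k).2 hk
      omega
    have htop := natDigit_top_ne_zero hl
    rw [levelKernel_eq hl]
    split_ifs with hag heq
    -- Both paths agree up to the top digit of `k`, and every node contributes `1`.
    · refine Finset.prod_eq_one fun v _ => ?_
      by_cases hv : v.length ≤ l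
      · have hpre : (List.range v.length).map ξ = (List.range v.length).map ξ' :=
          map_range_inj.2 fun d hd => hag d (hd.trans_le hv)
        have hξ : ξ v.length = ξ' v.length := by
          rcases hv.lt_or_eq with h | h
          · exact hag _ h
          · rw [h, heq]
        rw [nodeDigit, nodeDigit, hpre, hξ, permAvg_self]
      · simp [nodeDigit, natDigit_eq_zero_of_length_le (b := b) (k := k) (i := v.length) (by omega),
          permAvg_zero]
    -- The paths separate at the node reading the top digit of `k`, the only node to contribute.
    · rw [Finset.prod_eq_single_of_mem _ (hT l hln)]
      · have hpre : (List.range l).map ξ = (List.range l).map ξ' := map_range_inj.2 hag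
        rw [nodeDigit_prefix, hpre, nodeDigit_prefix]
        simpa using permAvg_of_ne_digit (by rwa [ne_eq, natDigit_cast_eq_zero]) heq
      · intro v _ hv
        rcases lt_trichotomy v.length l with h | h | h
        · have hpre : (List.range v.length).map ξ = (List.range v.length).map ξ' :=
            map_range_inj.2 fun d hd => hag d (hd.trans h)
          rw [nodeDigit, nodeDigit, hpre, hag _ h, permAvg_self]
        · have hpre : (List.range l).map ξ = (List.range l).map ξ' := map_range_inj.2 hag
          rw [nodeDigit, nodeDigit, h, ← hpre, if_neg hv, permAvg_zero]
        · simp [nodeDigit,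
            natDigit_eq_zero_of_length_le (b := b) (k := k) (i := v.length) (by omega),
            permAvg_zero]
    -- The paths separate before the top digit of `k` is read, so that the node where the path of `ξ`
    -- reads it is not on the path of `ξ'`.
    · refine Finset.prod_eq_zero (hT l hln) (permAvg_of_ne ?_ _ _)
      rw [nodeDigit_prefix, nodeDigit, if_neg (by simpa using hag), ne_eq, natDigit_cast_eq_zero]
      exact htop

/-- The multivariate Walsh function as a function of the digits of the coordinates. -/
def seqWalVec {s : ℕ} (k : Fin s → ℕ) (x : Fin s → ℕ → Fin b) : ℂ := ∏ j, seqWal (k j) (x j)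

/-- The scrambling of the digits of all coordinates with the permutations at `ω`. -/
def scrambleSeq {Ω : Type*} {s : ℕ} (perm : Fin s → List (Fin b) → Ω → Equiv.Perm (Fin b))
    (x : Fin s → ℕ → Fin b) (ω : Ω) : Fin s → ℕ → Fin b :=
  fun j => scrambleDigits (fun l => perm j l ω) (x j)

section
variable {s : ℕ} {Ω : Type*} [MeasurableSpace Ω] {μ : Measure Ω}
  {perm : Fin s → List (Fin b) → Ω → Equiv.Perm (Fin b)}

lemma IsScrambling.integral_comp {b s : ℕ} {Ω : Type*} [MeasurableSpace Ω] {μ : Measure Ω}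
    {perm : Fin s → List (Fin b) → Ω → Equiv.Perm (Fin b)} (hperm : IsScrambling μ perm)
    (j : Fin s) (l : List (Fin b))
    (g : Equiv.Perm (Fin b) → ℂ) :
    ∫ ω, g (perm j l ω) ∂μ = ((b.factorial : ℂ))⁻¹ * ∑ σ, g σ := by
  let _ : MeasurableSpace (Equiv.Perm (Fin b)) := ⊤
  have := hperm.indep.isProbabilityMeasure
  have hm := hperm.measurable j l
  have hg : StronglyMeasurable g := StronglyMeasurable.of_discrete
  have : IsProbabilityMeasure (μ.map (perm j l)) := Measure.isProbabilityMeasure_map hm.aemeasurable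
  rw [← integral_map hm.aemeasurable hg.aestronglyMeasurable,
    integral_fintype .of_finite, Finset.mul_sum]
  refine Finset.sum_congr rfl fun σ _ => ?_
  have : (μ.map (perm j l)).real {σ} = ((b.factorial : ℝ))⁻¹ := by
    rw [measureReal_def, Measure.map_apply hm (MeasurableSet.of_discrete)]
    have := hperm.uniform j l σ
    simp only [Set.preimage, Set.mem_singleton_iff, this]
    simp
  rw [this, Complex.real_smul]
  push_cast
  rfl

/-- The mixed moments of the scrambled Walsh functions. A Walsh function of a scrambled point is a
product over the nodes of the trees of digit sequences, and the permutations at different nodes are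
independent. -/
lemma IsScrambling.integral_seqWalVec (hperm : IsScrambling μ perm) (k k' : Fin s → ℕ)
    (x x' : Fin s → ℕ → Fin b) :
    ∫ ω, seqWalVec k (scrambleSeq perm x ω) *
        (starRingEnd ℂ) (seqWalVec k' (scrambleSeq perm x' ω)) ∂μ =
      if k = k' then ∏ j, levelKernel (k j) (x j) (x' j) else 0 := by
  classical
  let _ : MeasurableSpace (Equiv.Perm (Fin b)) := ⊤
  obtain ⟨n, hn⟩ : ∃ n, ∀ j, k j < b ^ n ∧ k' j < b ^ n := by
    refine ⟨∑ j, (k j + k' j), fun j => ?_⟩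
    have h1 : k j + k' j ≤ ∑ j, (k j + k' j) :=
      Finset.single_le_sum (f := fun j => k j + k' j) (fun _ _ => Nat.zero_le _) (Finset.mem_univ j)
    have h2 := Nat.lt_pow_self (n := ∑ j, (k j + k' j)) (one_lt_base (b := b))
    omega
  let T : Finset (List (Fin b)) := Finset.univ.biUnion fun j : Fin s =>
    (Finset.range n).image (fun i => (List.range i).map (x j)) ∪
      (Finset.range n).image (fun i => (List.range i).map (x' j))
  have hT : ∀ j, ∀ i < n, (List.range i).map (x j) ∈ T := fun j i hi =>
    Finset.mem_biUnion.2 ⟨j, Finset.mem_univ _, Finset.mem_union_left _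
      (Finset.mem_image_of_mem _ (Finset.mem_range.2 hi))⟩
  have hT' : ∀ j, ∀ i < n, (List.range i).map (x' j) ∈ T := fun j i hi =>
    Finset.mem_biUnion.2 ⟨j, Finset.mem_univ _, Finset.mem_union_right _
      (Finset.mem_image_of_mem _ (Finset.mem_range.2 hi))⟩
  let g : Fin s × List (Fin b) → Equiv.Perm (Fin b) → ℂ := fun v σ =>
    chi (nodeDigit (k v.1) (x v.1) v.2 * digitRes (σ (x v.1 v.2.length))) *
      (starRingEnd ℂ)
        (chi (nodeDigit (k' v.1) (x' v.1) v.2 * digitRes (σ (x' v.1 v.2.length))))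
  let S : Finset (Fin s × List (Fin b)) := Finset.univ ×ˢ T
  have h1 : ∀ ω, seqWalVec k (scrambleSeq perm x ω) *
      (starRingEnd ℂ) (seqWalVec k' (scrambleSeq perm x' ω)) =
      ∏ v : S, g v (perm v.1.1 v.1.2 ω) := by
    intro ω
    rw [Finset.prod_coe_sort S (fun v => g v (perm v.1 v.2 ω)), Finset.prod_product, seqWalVec,
      seqWalVec, map_prod, ← Finset.prod_mul_distrib]
    refine Finset.prod_congr rfl fun j _ => ?_
    rw [scrambleSeq, scrambleSeq, seqWal_scrambleDigits (hn j).1 (x j) T (hT j),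
      seqWal_scrambleDigits (hn j).2 (x' j) T (hT' j), map_prod, ← Finset.prod_mul_distrib]
  have hind : iIndepFun (fun (v : S) ω => g v (perm v.1.1 v.1.2 ω)) μ :=
    (hperm.indep.precomp (g := fun v : S => v.1) Subtype.val_injective).comp (fun v => g v)
      fun v => measurable_from_top
  simp_rw [h1]
  rw [hind.integral_fun_prod_eq_prod_integral fun v =>
    ((measurable_from_top (f := g v)).comp
      (hperm.measurable v.1.1 v.1.2)).aestronglyMeasurable]
  rw [Finset.prod_coe_sort S (fun v => ∫ ω, g v (perm v.1 v.2 ω) ∂μ), Finset.prod_product]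
  have h2 : ∀ j v, ∫ ω, g (j, v) (perm j v ω) ∂μ =
      permAvg (nodeDigit (k j) (x j) v) (nodeDigit (k' j) (x' j) v) (x j v.length)
        (x' j v.length) := fun j v => hperm.integral_comp j v _
  simp_rw [h2]
  split_ifs with h
  · subst h
    exact Finset.prod_congr rfl fun j _ => prod_permAvg_self (hn j).1 _ _ T (hT j)
  · obtain ⟨j, hj⟩ := Function.ne_iff.1 h
    exact Finset.prod_eq_zero (Finset.mem_univ j)
      (prod_permAvg_of_ne (hn j).1 (hn j).2 _ _ T (hT j) (hT' j) hj)

/-- The kernel of a vector of levels is an average over the corresponding box of frequencies. -/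
lemma prod_levelKernel (k : Fin s → ℕ) (x x' : Fin s → ℕ → Fin b) :
    ∏ j, levelKernel (k j) (x j) (x' j) =
      ((Fintype.piFinset fun j => level b (k j)).card : ℂ)⁻¹ *
        ∑ κ ∈ Fintype.piFinset fun j => level b (k j),
          seqWalVec κ x * (starRingEnd ℂ) (seqWalVec κ x') := by
  simp only [levelKernel, Finset.prod_mul_distrib, Finset.prod_inv_distrib, Fintype.card_piFinset,
    Finset.prod_univ_sum, seqWalVec, map_prod, Nat.cast_prod]

end
end

/-! ### Integrals of Walsh functions over the unit cube -/

section
variable {b : ℕ} [Fact b.Prime]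

lemma wal_eq_prod_floor (k : ℕ) {x : ℝ} (hx : 0 ≤ x) :
    wal b k x = ∏ i ∈ Finset.range (Nat.digits b k).length,
      chi ((natDigit b k i : ZMod b) * ((⌊x * (b : ℝ) ^ (i + 1)⌋ : ℤ) : ZMod b)) := by
  rw [wal_eq_seqWal, seqWal]
  refine Finset.prod_congr rfl fun i _ => ?_
  rw [Real.digits, digitRes_ofNat, ← Int.natCast_floor_eq_floor (by positivity), Int.cast_natCast]

/-- A nontrivial Walsh function has mean zero: let `i` be the position of the first nonzero digit of
`k`. A translation by `b ^ (-(i + 1))` increases the `i`-th digit of the argument by one, and the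
carries affect only digits that `wal_k` does not see. -/
lemma integral_wal {k : ℕ} (hk : k ≠ 0) : ∫ x in (0 : ℝ)..1, wal b k x = 0 := by
  classical
  let g : ℝ → ℂ := fun x => ∏ i ∈ Finset.range (Nat.digits b k).length,
      chi ((natDigit b k i : ZMod b) * ((⌊x * (b : ℝ) ^ (i + 1)⌋ : ℤ) : ZMod b))
  have hg : ∫ x in (0 : ℝ)..1, wal b k x = ∫ x in (0 : ℝ)..1, g x := by
    refine intervalIntegral.integral_congr fun x hx => wal_eq_prod_floor k ?_
    rw [Set.uIcc_of_le zero_le_one] at hx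
    exact hx.1
  have hb0 : (b : ℝ) ≠ 0 := NeZero.ne _
  have hper : Function.Periodic g 1 := by
    intro x
    refine Finset.prod_congr rfl fun i _ => ?_
    have : (x + 1) * (b : ℝ) ^ (i + 1) = x * (b : ℝ) ^ (i + 1) + ((b ^ (i + 1) : ℕ) : ℤ) := by
      push_cast; ring
    rw [this, Int.floor_add_intCast]
    simp
  have hex : ∃ i, natDigit b k i ≠ 0 := by
    by_contra! h
    exact hk (eq_of_natDigit_eq (b := b) fun i => by rw [h i]; simp [natDigit])
  let i₀ := Nat.find hex
  have hi₀ : natDigit b k i₀ ≠ 0 := Nat.find_spec hex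
  have hmin : ∀ i < i₀, natDigit b k i = 0 := fun i hi => not_not.1 (Nat.find_min hex hi)
  have hlen : i₀ < (Nat.digits b k).length := by
    by_contra! h
    exact hi₀ (natDigit_eq_zero_of_length_le h)
  have hshift : ∀ x, g (x + ((b : ℝ) ^ (i₀ + 1))⁻¹) = chi (natDigit b k i₀ : ZMod b) * g x := by
    intro x
    have h1 : chi (natDigit b k i₀ : ZMod b) = ∏ i ∈ Finset.range (Nat.digits b k).length,
        chi ((natDigit b k i : ZMod b) * if i = i₀ then 1 else 0) := by
      rw [Finset.prod_eq_single_of_mem i₀ (Finset.mem_range.2 hlen)]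
      · simp
      · intro i _ hi
        simp [hi]
    rw [h1, ← Finset.prod_mul_distrib]
    refine Finset.prod_congr rfl fun i _ => ?_
    rcases lt_or_ge i i₀ with hi | hi
    · simp [hmin i hi]
    · obtain ⟨d, rfl⟩ := Nat.exists_eq_add_of_le hi
      have : (x + ((b : ℝ) ^ (i₀ + 1))⁻¹) * (b : ℝ) ^ (i₀ + d + 1) =
          x * (b : ℝ) ^ (i₀ + d + 1) + ((b ^ d : ℕ) : ℤ) := by
        push_cast
        field_simp
        ring
      rw [this, Int.floor_add_intCast, ← AddChar.map_add_eq_mul]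
      congr 1
      rcases Nat.eq_zero_or_pos d with rfl | hd
      · push_cast
        simp
        ring
      · simp [hd.ne']
  have hint : chi (natDigit b k i₀ : ZMod b) * ∫ x in (0 : ℝ)..1, g x =
      ∫ x in (0 : ℝ)..1, g x := by
    rw [← intervalIntegral.integral_const_mul]
    simp_rw [← hshift]
    rw [intervalIntegral.integral_comp_add_right]
    have := hper.intervalIntegral_add_eq ((b : ℝ) ^ (i₀ + 1))⁻¹ 0
    rw [zero_add] at this
    rw [zero_add, add_comm (1 : ℝ), this]
  have hne : chi (natDigit b k i₀ : ZMod b) - 1 ≠ 0 :=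
    sub_ne_zero.2 (chi_ne_one fun h => hi₀ (natDigit_cast_eq_zero.1 h))
  rw [hg]
  refine (mul_eq_zero.1 ?_).resolve_left hne
  rw [sub_mul, hint, one_mul, sub_self]

end

lemma cubeMeasure_eq_pi (s : ℕ) :
    cubeMeasure s = Measure.pi fun _ : Fin s => (volume : Measure ℝ).restrict (Set.Icc 0 1) := by
  rw [cubeMeasure, ← Set.pi_univ_Icc, volume_pi, Measure.restrict_pi_pi]
  rfl

instance (s : ℕ) : IsProbabilityMeasure (cubeMeasure s) := by
  have : IsProbabilityMeasure ((volume : Measure ℝ).restrict (Set.Icc 0 1)) := ⟨by simp⟩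
  rw [cubeMeasure_eq_pi]
  infer_instance

section
variable {b : ℕ} [Fact b.Prime] {s : ℕ}

lemma integral_walVec (k : Fin s → ℕ) :
    ∫ x, walVec b k x ∂(cubeMeasure s) = if k = 0 then 1 else 0 := by
  simp only [walVec]
  rw [cubeMeasure_eq_pi, integral_fintype_prod_eq_prod (fun j x => wal b (k j) x)]
  split_ifs with h
  · subst h
    simp [wal_eq_seqWal]
  · obtain ⟨j, hj⟩ := Function.ne_iff.1 h
    refine Finset.prod_eq_zero (Finset.mem_univ j) ?_
    rw [integral_Icc_eq_integral_Ioc, ← intervalIntegral.integral_of_le zero_le_one]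
    exact integral_wal hj

/-- The digits of the coordinates of a point. -/
def digitMap (b : ℕ) [NeZero b] (x : Fin s → ℝ) : Fin s → ℕ → Fin b :=
  fun j => Real.digits (x j) b

/-- The point with given digits. -/
def digitPoint (x : Fin s → ℕ → Fin b) : Fin s → ℝ := fun j => Real.ofDigits (x j)

/-- The distribution of the digits of a uniformly distributed point of the cube. -/
def digitMeasure (b : ℕ) [NeZero b] (s : ℕ) : Measure (Fin s → ℕ → Fin b) :=
  (cubeMeasure s).map (digitMap b)

lemma measurable_digitMap : Measurable (digitMap b (s := s)) := by
  refine measurable_pi_lambda _ fun j => measurable_pi_lambda _ fun i => ?_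
  have h1 : Measurable fun x : Fin s → ℝ => ⌊x j * (b : ℝ) ^ (i + 1)⌋₊ :=
    Nat.measurable_floor.comp ((measurable_pi_apply j).mul_const _)
  exact (measurable_from_top (f := Fin.ofNat b)).comp h1

lemma measurable_digitPoint {b s : ℕ} : Measurable (digitPoint (b := b) (s := s)) :=
  measurable_pi_lambda _ fun j => Real.continuous_ofDigits.measurable.comp (measurable_pi_apply j)

instance : IsProbabilityMeasure (digitMeasure b s) :=
  Measure.isProbabilityMeasure_map measurable_digitMap.aemeasurable

lemma digitPoint_digitMap_ae :
    (fun x => digitPoint (digitMap b x)) =ᵐ[cubeMeasure s] id := by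
  have h : cubeMeasure s =
      (volume : Measure (Fin s → ℝ)).restrict (Set.univ.pi fun _ => Set.Ico 0 1) := by
    rw [cubeMeasure]
    exact Measure.restrict_congr_set (Measure.univ_pi_Ico_ae_eq_Icc (f := 0) (g := 1)).symm
  rw [h]
  filter_upwards [ae_restrict_mem (MeasurableSet.univ_pi fun _ => measurableSet_Ico)] with x hx
  funext j
  exact Real.ofDigits_digits one_lt_base (hx j (Set.mem_univ j))

lemma measurePreserving_digitPoint :
    MeasurePreserving (digitPoint (b := b) (s := s)) (digitMeasure b s) (cubeMeasure s) := by
  refine ⟨measurable_digitPoint, ?_⟩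
  rw [digitMeasure, Measure.map_map measurable_digitPoint measurable_digitMap,
    Measure.map_congr (f := digitPoint ∘ digitMap b) (g := id) digitPoint_digitMap_ae,
    Measure.map_id]

lemma walVec_eq (k : Fin s → ℕ) (x : Fin s → ℝ) : walVec b k x = seqWalVec k (digitMap b x) := by
  simp only [walVec, seqWalVec, wal_eq_seqWal, digitMap]

lemma measurable_seqWalVec (k : Fin s → ℕ) : Measurable (seqWalVec (b := b) k) := by
  refine Finset.measurable_fun_prod _ fun j _ => Finset.measurable_fun_prod _ fun i _ => ?_
  exact (measurable_from_top
    (f := fun a : Fin b => chi ((natDigit b (k j) i : ZMod b) * digitRes a))).comp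
    ((measurable_pi_apply i).comp (measurable_pi_apply j))

lemma norm_seqWalVec (k : Fin s → ℕ) (x : Fin s → ℕ → Fin b) : ‖seqWalVec k x‖ = 1 := by
  simp only [seqWalVec, norm_prod, norm_seqWal, Finset.prod_const_one]

@[simp] lemma seqWalVec_zero (x : Fin s → ℕ → Fin b) : seqWalVec 0 x = 1 := by
  simp [seqWalVec]

lemma integral_seqWalVec_digitMeasure (k : Fin s → ℕ) :
    ∫ x, seqWalVec k x ∂(digitMeasure b s) = if k = 0 then 1 else 0 := by
  rw [digitMeasure, integral_map measurable_digitMap.aemeasurable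
    (measurable_seqWalVec k).aestronglyMeasurable, ← integral_walVec (b := b) k]
  simp_rw [walVec_eq]

/-! ### Walsh functions determine measures and integrable functions -/

/-- The set of all `x` that share the first `n` digits of each coordinate with `c`. -/
def cyl (n : ℕ) (c : Fin s → ℕ → Fin b) : Set (Fin s → ℕ → Fin b) :=
  {x | ∀ j, ∀ i < n, x j i = c j i}

lemma measurableSet_cyl {b s : ℕ} (n : ℕ) (c : Fin s → ℕ → Fin b) : MeasurableSet (cyl n c) := by
  have : cyl n c = ⋂ j, ⋂ i, ⋂ _ : i < n, (fun x => x j i) ⁻¹' {c j i} := by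
    ext x
    simp [cyl]
  rw [this]
  refine MeasurableSet.iInter fun j => MeasurableSet.iInter fun i => MeasurableSet.iInter fun _ => ?_
  exact ((measurable_pi_apply i).comp (measurable_pi_apply j)) (MeasurableSet.of_discrete)

lemma isPiSystem_cyl {b s : ℕ} : IsPiSystem {A | ∃ n, ∃ c : Fin s → ℕ → Fin b, A = cyl n c} := by
  rintro _ ⟨n, c, rfl⟩ _ ⟨n', c', rfl⟩ ⟨z, hz, hz'⟩
  refine ⟨max n n', z, ?_⟩
  ext x
  constructor
  · rintro ⟨hx, hx'⟩ j i hi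
    rcases lt_max_iff.1 hi with h | h
    · rw [hx j i h, hz j i h]
    · rw [hx' j i h, hz' j i h]
  · intro hx
    exact ⟨fun j i hi => (hx j i (lt_max_of_lt_left hi)).trans (hz j i hi),
      fun j i hi => (hx j i (lt_max_of_lt_right hi)).trans (hz' j i hi)⟩

lemma generateFrom_cyl :
    (inferInstance : MeasurableSpace (Fin s → ℕ → Fin b)) =
      MeasurableSpace.generateFrom {A | ∃ n, ∃ c : Fin s → ℕ → Fin b, A = cyl n c} := by
  apply le_antisymm
  · refine iSup_le fun j => ?_
    rw [← measurable_iff_comap_le]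
    refine @measurable_pi_lambda _ _ _ (_) _ _ fun i => ?_
    refine @measurable_to_countable' _ _ _ _ (_) _ fun a => ?_
    -- The extension of finitely many digits by zeros.
    let pad : (Fin s → Fin (i + 1) → Fin b) → Fin s → ℕ → Fin b :=
      fun f j d => if h : d < i + 1 then f j ⟨d, h⟩ else 0
    have : (fun x : Fin s → ℕ → Fin b => x j i) ⁻¹' {a} =
        ⋃ f : Fin s → Fin (i + 1) → Fin b, ⋃ _ : f j (Fin.last i) = a, cyl (i + 1) (pad f) := by
      ext x
      simp only [Set.mem_preimage, Set.mem_singleton_iff, Set.mem_iUnion, exists_prop]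
      constructor
      · intro hx
        refine ⟨fun j d => x j d, hx, fun j d hd => ?_⟩
        simp only [pad, dif_pos hd]
      · rintro ⟨f, hf, hx⟩
        rw [hx j i (Nat.lt_succ_self i), ← hf]
        simp [pad, Fin.last]
    rw [this]
    exact MeasurableSet.iUnion fun f => MeasurableSet.iUnion fun _ =>
      MeasurableSpace.measurableSet_generateFrom ⟨_, _, rfl⟩
  · refine MeasurableSpace.generateFrom_le ?_
    rintro _ ⟨n, c, rfl⟩
    exact measurableSet_cyl n c

/-- Walsh expansion of the indicator function of a cylinder. -/
lemma indicator_cyl (n : ℕ) (c x : Fin s → ℕ → Fin b) :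
    (cyl n c).indicator (fun _ => (1 : ℂ)) x = (((b : ℂ) ^ n) ^ s)⁻¹ *
      ∑ k ∈ Fintype.piFinset fun _ : Fin s => Finset.range (b ^ n),
        seqWalVec k c * (starRingEnd ℂ) (seqWalVec k x) := by
  have h1 : ∑ k ∈ Fintype.piFinset fun _ : Fin s => Finset.range (b ^ n),
        seqWalVec k c * (starRingEnd ℂ) (seqWalVec k x) =
      ∏ j, if ∀ i < n, c j i = x j i then (b : ℂ) ^ n else 0 := by
    simp_rw [← sum_seqWal_mul_conj]
    rw [Finset.prod_univ_sum]
    simp only [seqWalVec, map_prod, Finset.prod_mul_distrib]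
  have hb0 : (b : ℂ) ≠ 0 := NeZero.ne _
  rw [h1]
  by_cases hx : x ∈ cyl n c
  · rw [Set.indicator_of_mem hx, Finset.prod_congr rfl
      fun j _ => if_pos fun i hi => (hx j i hi).symm]
    simp [hb0]
  · rw [Set.indicator_of_notMem hx]
    simp only [cyl, Set.mem_ofPred_eq] at hx
    push Not at hx
    obtain ⟨j, i, hi, hne⟩ := hx
    rw [Finset.prod_eq_zero (Finset.mem_univ j) (if_neg fun h => hne (h i hi).symm), mul_zero]

lemma integrable_mul_conj_seqWalVec {P : Measure (Fin s → ℕ → Fin b)}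
    {F : (Fin s → ℕ → Fin b) → ℂ} (hF : Integrable F P) (k : Fin s → ℕ) :
    Integrable (fun x => F x * (starRingEnd ℂ) (seqWalVec k x)) P := by
  refine hF.mul_bdd (c := 1)
    (Complex.continuous_conj.measurable.comp (measurable_seqWalVec k)).aestronglyMeasurable ?_
  exact Filter.Eventually.of_forall fun x => by simp [norm_seqWalVec]

lemma setIntegral_cyl {P : Measure (Fin s → ℕ → Fin b)}
    {F : (Fin s → ℕ → Fin b) → ℂ} (hF : Integrable F P) (n : ℕ) (c : Fin s → ℕ → Fin b) :
    ∫ x in cyl n c, F x ∂P = (((b : ℂ) ^ n) ^ s)⁻¹ *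
      ∑ k ∈ Fintype.piFinset fun _ : Fin s => Finset.range (b ^ n),
        seqWalVec k c * ∫ x, F x * (starRingEnd ℂ) (seqWalVec k x) ∂P := by
  have h1 : ∀ x, (cyl n c).indicator F x = (((b : ℂ) ^ n) ^ s)⁻¹ *
      ∑ k ∈ Fintype.piFinset fun _ : Fin s => Finset.range (b ^ n),
        seqWalVec k c * (F x * (starRingEnd ℂ) (seqWalVec k x)) := by
    intro x
    have : (cyl n c).indicator F x = F x * (cyl n c).indicator (fun _ => (1 : ℂ)) x := by
      by_cases hx : x ∈ cyl n c <;> simp [hx]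
    rw [this, indicator_cyl, mul_left_comm, Finset.mul_sum]
    congr 1
    exact Finset.sum_congr rfl fun k _ => mul_left_comm _ _ _
  rw [← integral_indicator (measurableSet_cyl n c)]
  simp_rw [h1]
  rw [integral_const_mul, integral_finsetSum]
  · simp_rw [integral_const_mul]
  · intro k _
    exact (integrable_mul_conj_seqWalVec hF k).const_mul _

lemma eq_of_integral_seqWalVec_eq {P Q : Measure (Fin s → ℕ → Fin b)} [IsProbabilityMeasure P]
    [IsProbabilityMeasure Q]
    (h : ∀ k : Fin s → ℕ, ∫ x, seqWalVec k x ∂P = ∫ x, seqWalVec k x ∂Q) : P = Q := by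
  refine ext_of_generate_finite _ generateFrom_cyl isPiSystem_cyl ?_ (by simp)
  rintro _ ⟨n, c, rfl⟩
  have h1 := setIntegral_cyl (P := P) (integrable_const 1) n c
  have h2 := setIntegral_cyl (P := Q) (integrable_const 1) n c
  simp only [one_mul, integral_conj, h] at h1 h2
  rw [← h2] at h1
  simp only [integral_const, Complex.real_smul, mul_one, measureReal_restrict_apply_univ] at h1
  exact (measureReal_eq_measureReal_iff).1 (by exact_mod_cast h1)

/-- Completeness of the Walsh system. -/
lemma ae_eq_zero_of_integral_mul_conj_seqWalVec {P : Measure (Fin s → ℕ → Fin b)}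
    [IsFiniteMeasure P] {F : (Fin s → ℕ → Fin b) → ℂ} (hF : Integrable F P)
    (h : ∀ k, ∫ x, F x * (starRingEnd ℂ) (seqWalVec k x) ∂P = 0) : F =ᵐ[P] 0 := by
  refine ae_eq_zero_of_forall_setIntegral_eq_of_sigmaFinite (fun A _ _ => hF.integrableOn) ?_
  have huniv : ∫ x, F x ∂P = 0 := by simpa using h 0
  have key : ∀ A (_ : MeasurableSet A), ∫ x in A, F x ∂P = 0 := by
    refine MeasurableSpace.induction_on_inter generateFrom_cyl isPiSystem_cyl (by simp) ?_ ?_ ?_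
    · rintro _ ⟨n, c, rfl⟩
      rw [setIntegral_cyl hF]
      simp [h]
    · intro A hA h0
      have := integral_add_compl hA hF
      rwa [h0, huniv, zero_add] at this
    · intro f hd hm h0
      rw [integral_iUnion hm hd hF.integrableOn]
      simp [h0]
  exact fun A hA _ => key A hA

/-- Each scrambled point is uniformly distributed. -/
lemma IsScrambling.measurePreserving_scrambleSeq {Ω : Type*} [MeasurableSpace Ω] {μ : Measure Ω}
    {perm : Fin s → List (Fin b) → Ω → Equiv.Perm (Fin b)} (hperm : IsScrambling μ perm)
    (x : Fin s → ℕ → Fin b) :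
    MeasurePreserving (scrambleSeq perm x) μ (digitMeasure b s) := by
  have := hperm.indep.isProbabilityMeasure
  have hm : Measurable (scrambleSeq perm x) := by
    refine measurable_pi_lambda _ fun j => measurable_pi_lambda _ fun i => ?_
    exact (measurable_from_top (f := fun σ : Equiv.Perm (Fin b) => σ (x j i))).comp
      (hperm.measurable j _)
  refine ⟨hm, ?_⟩
  have := Measure.isProbabilityMeasure_map (μ := μ) hm.aemeasurable
  refine eq_of_integral_seqWalVec_eq fun k => ?_
  rw [integral_map hm.aemeasurable (measurable_seqWalVec k).aestronglyMeasurable,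
    integral_seqWalVec_digitMeasure]
  have h := hperm.integral_seqWalVec k 0 x x
  simp only [seqWalVec_zero, map_one, mul_one] at h
  rw [h]
  split_ifs with h0
  · subst h0
    simp [levelKernel_zero]
  · rfl

end

/-! ### Walsh sums over the polynomial lattice -/

section
variable {b : ℕ} [Fact b.Prime]

lemma toLaurent_mul (f g : (ZMod b)[X]) : toLaurent b (f * g) = toLaurent b f * toLaurent b g := by
  simp [toLaurent]

lemma toLaurent_add (f g : (ZMod b)[X]) : toLaurent b (f + g) = toLaurent b f + toLaurent b g := by
  simp [toLaurent]

lemma toLaurent_sum {ι : Type*} (S : Finset ι) (f : ι → (ZMod b)[X]) :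
    toLaurent b (∑ i ∈ S, f i) = ∑ i ∈ S, toLaurent b (f i) := by
  simp [toLaurent]

lemma toLaurent_monomial (n : ℕ) (a : ZMod b) :
    toLaurent b (Polynomial.monomial n a) = HahnSeries.single (-(n : ℤ)) a := by
  rw [toLaurent, Polynomial.aeval_monomial, HahnSeries.single_pow, one_pow]
  have h : algebraMap (ZMod b) (LaurentSeries (ZMod b)) a = HahnSeries.C a := by
    rw [← ZMod.natCast_zmod_val a, map_natCast, map_natCast]
  rw [h, HahnSeries.C_apply, HahnSeries.single_mul_single]
  simp

lemma coeff_toLaurent (g : (ZMod b)[X]) (n : ℤ) :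
    (toLaurent b g).coeff n = if n ≤ 0 then g.coeff (-n).toNat else 0 := by
  induction g using Polynomial.induction_on' with
  | add f g hf hg =>
    rw [toLaurent_add, HahnSeries.coeff_add, hf, hg]
    split_ifs <;> simp
  | monomial i a =>
    rw [toLaurent_monomial, HahnSeries.coeff_single, Polynomial.coeff_monomial]
    split_ifs <;> first | rfl | omega

lemma toLaurent_ne_zero {g : (ZMod b)[X]} (hg : g ≠ 0) : toLaurent b g ≠ 0 := by
  intro h
  have := coeff_toLaurent g (-(g.natDegree : ℤ))
  simp only [h, HahnSeries.coeff_zero] at this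
  simp [hg, eq_comm (a := (0 : ZMod b))] at this

lemma order_toLaurent {g : (ZMod b)[X]} (hg : g ≠ 0) :
    (toLaurent b g).order = -(g.natDegree : ℤ) := by
  have hne := toLaurent_ne_zero hg
  apply le_antisymm
  · refine HahnSeries.order_le_of_coeff_ne_zero ?_
    simp [coeff_toLaurent, hg]
  · by_contra! hlt
    have h0 := HahnSeries.coeff_order_eq_zero.not.2 hne
    rw [coeff_toLaurent] at h0
    split_ifs at h0
    · exact h0 (Polynomial.coeff_eq_zero_of_natDegree_lt (by omega))
    · exact h0 rfl

/-- The coefficients of `x⁻¹, …, x⁻ᵐ` in the expansion of `g / p` with `deg p = m` detect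
divisibility: the fractional part of `g / p` is `r / p` with the remainder `r` of `g`, whose leading
term is that of `x ^ (deg r - m)`. -/
lemma exists_coeff_div_ne_zero {p g : (ZMod b)[X]} {m : ℕ} (hp : p.degree = m) (hpg : ¬ p ∣ g) :
    ∃ i < m, (toLaurent b g / toLaurent b p).coeff ((i : ℤ) + 1) ≠ 0 := by
  have hp0 : p ≠ 0 := by
    rintro rfl
    simp at hp
  have hpm : p.natDegree = m := Polynomial.natDegree_eq_of_degree_eq_some hp
  have hr0 : g % p ≠ 0 := fun h => hpg (EuclideanDomain.mod_eq_zero.1 h)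
  have hdeg : (g % p).natDegree < m := by
    rw [← hpm]
    exact Polynomial.natDegree_lt_natDegree hr0 (Polynomial.degree_mod_lt g hp0)
  have hP := toLaurent_ne_zero hp0
  have hR := toLaurent_ne_zero hr0
  have hL0 : toLaurent b (g % p) / toLaurent b p ≠ 0 := div_ne_zero hR hP
  have hord : (toLaurent b (g % p) / toLaurent b p).order = (m : ℤ) - (g % p).natDegree := by
    have h1 := HahnSeries.order_mul hL0 hP
    rw [div_mul_cancel₀ _ hP, order_toLaurent hr0, order_toLaurent hp0, hpm] at h1
    omega
  have hsplit : toLaurent b g / toLaurent b p =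
      toLaurent b (g / p) + toLaurent b (g % p) / toLaurent b p := by
    conv_lhs => rw [← EuclideanDomain.div_add_mod g p]
    rw [toLaurent_add, toLaurent_mul, add_div, mul_div_cancel_left₀ _ hP]
  refine ⟨m - (g % p).natDegree - 1, by omega, ?_⟩
  have hi : ((m - (g % p).natDegree - 1 : ℕ) : ℤ) + 1 = (m : ℤ) - (g % p).natDegree := by omega
  rw [hi, hsplit, HahnSeries.coeff_add, coeff_toLaurent, if_neg (by omega), zero_add, ← hord]
  exact HahnSeries.coeff_order_eq_zero.not.2 hL0

/-- The coefficient of `x⁻¹` turns multiplication by a polynomial into a linear form in the digits. -/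
lemma coeff_one_truncPoly_mul (m k : ℕ) (L : LaurentSeries (ZMod b)) :
    (toLaurent b (truncPoly b m k) * L).coeff 1 =
      ∑ i ∈ Finset.range m, (natDigit b k i : ZMod b) * L.coeff ((i : ℤ) + 1) := by
  rw [truncPoly, toLaurent_sum, Finset.sum_mul, HahnSeries.coeff_sum]
  refine Finset.sum_congr rfl fun i _ => ?_
  rw [toLaurent_monomial, HahnSeries.coeff_single_mul]
  congr 2
  ring

lemma natDigit_finFunctionFinEquiv {b m : ℕ} (f : Fin m → Fin b) (i : Fin m) :
    natDigit b (finFunctionFinEquiv f : ℕ) i = f i := by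
  conv_rhs => rw [← finFunctionFinEquiv.symm_apply_apply f]
  rfl

lemma digitRes_digits_vmap (m : ℕ) (L : LaurentSeries (ZMod b)) (i : ℕ) :
    digitRes (Real.digits (vmap b m L) b i) = if i < m then L.coeff ((i : ℤ) + 1) else 0 := by
  -- The `d`-th digit of the integer `b ^ m * vmap b m L` is the coefficient of `x ^ (-(m - d))`.
  let f : Fin m → Fin b := fun d => ⟨(L.coeff ((m - d : ℕ) : ℤ)).val, ZMod.val_lt _⟩
  have hb0 : (b : ℝ) ≠ 0 := NeZero.ne _
  have hv : vmap b m L = ((finFunctionFinEquiv f : ℕ) : ℝ) / (b : ℝ) ^ m := by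
    rw [finFunctionFinEquiv_apply, vmap]
    push_cast
    rw [Finset.sum_div, Fin.sum_univ_eq_sum_range
      (fun d => ((L.coeff ((m - d : ℕ) : ℤ)).val : ℝ) * (b : ℝ) ^ d / (b : ℝ) ^ m) m]
    refine Finset.sum_nbij' (fun l => m - l) (fun d => m - d) ?_ ?_ ?_ ?_ ?_
    · intro l hl; simp at hl ⊢; omega
    · intro d hd; simp at hd ⊢; omega
    · intro l hl; simp at hl ⊢; omega
    · intro d hd; simp at hd ⊢; omega
    · intro l hl
      have hl' : l ≤ m := (Finset.mem_Icc.1 hl).2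
      obtain ⟨d, rfl⟩ := Nat.exists_eq_add_of_le hl'
      simp only [Nat.add_sub_cancel_left, Nat.add_sub_cancel_right]
      field_simp
      ring
  rw [Real.digits, digitRes_ofNat, hv]
  split_ifs with hi
  · obtain ⟨d, rfl⟩ := Nat.exists_eq_add_of_lt hi
    have h1 : ((finFunctionFinEquiv f : ℕ) : ℝ) / (b : ℝ) ^ (i + d + 1) * (b : ℝ) ^ (i + 1) =
        ((finFunctionFinEquiv f : ℕ) : ℝ) / ((b ^ d : ℕ) : ℝ) := by
      push_cast
      field_simp
      ring
    have h2 := natDigit_finFunctionFinEquiv f ⟨d, by omega⟩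
    rw [h1, Nat.floor_div_eq_div, ← ZMod.natCast_mod]
    rw [natDigit] at h2
    rw [h2]
    have h3 : i + d + 1 - d = i + 1 := by omega
    simp [f, h3]
  · obtain ⟨d, rfl⟩ := Nat.exists_eq_add_of_le (not_lt.1 hi)
    have h1 : ((finFunctionFinEquiv f : ℕ) : ℝ) / (b : ℝ) ^ m * (b : ℝ) ^ (m + d + 1) =
        (((finFunctionFinEquiv f : ℕ) * b ^ (d + 1) : ℕ) : ℝ) := by
      push_cast
      field_simp
      ring
    rw [h1, Nat.floor_natCast]
    simp

variable {s : ℕ}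

lemma seqWalVec_latticePoint (m : ℕ) (p : (ZMod b)[X]) (q : Fin s → (ZMod b)[X]) (κ : Fin s → ℕ)
    (h : ℕ) :
    seqWalVec κ (digitMap b (latticePoint m p q h)) =
      ∏ i ∈ Finset.range m, chi ((natDigit b h i : ZMod b) *
        (toLaurent b (∑ j, truncPoly b m (κ j) * q j) / toLaurent b p).coeff ((i : ℤ) + 1)) := by
  rw [← chi_sum, ← coeff_one_truncPoly_mul, ← mul_div_assoc, ← toLaurent_mul, Finset.mul_sum,
    toLaurent_sum, Finset.sum_div, HahnSeries.coeff_sum, chi_sum, seqWalVec]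
  refine Finset.prod_congr rfl fun j _ => ?_
  rw [mul_left_comm, toLaurent_mul, mul_div_assoc, coeff_one_truncPoly_mul, chi_sum]
  have hlt : κ j < b ^ max m (Nat.digits b (κ j)).length :=
    (lt_pow_digits_length _).trans_le (Nat.pow_le_pow_right (NeZero.pos b) (le_max_right _ _))
  rw [seqWal_eq_prod_range hlt]
  symm
  refine Finset.prod_subset_one_on_sdiff (Finset.range_mono (le_max_left _ _)) ?_ ?_
  · intro i hi
    have him : ¬ i < m := fun h => (Finset.mem_sdiff.1 hi).2 (Finset.mem_range.2 h)
    rw [digitMap, latticePoint, digitRes_digits_vmap, if_neg him]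
    simp
  · intro i hi
    rw [digitMap, latticePoint, digitRes_digits_vmap, if_pos (Finset.mem_range.1 hi)]

/-- The Walsh functions outside the dual lattice are integrated exactly to zero by the polynomial
lattice rule. -/
lemma sum_seqWalVec_latticePoint {m : ℕ} {p : (ZMod b)[X]} (hp : p.degree = m)
    (q : Fin s → (ZMod b)[X]) {κ : Fin s → ℕ} (hκ : κ ∉ dualLattice m p q) :
    ∑ h ∈ Finset.range (b ^ m), seqWalVec κ (digitMap b (latticePoint m p q h)) = 0 := by
  obtain ⟨i, hi, hne⟩ := exists_coeff_div_ne_zero hp hκ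
  simp_rw [seqWalVec_latticePoint]
  rw [sum_prod_chi m fun i =>
    (toLaurent b (∑ j, truncPoly b m (κ j) * q j) / toLaurent b p).coeff ((i : ℤ) + 1)]
  exact if_neg fun h => hne (h i hi)

end

/-! ### The scrambled estimator on the Walsh basis -/

section
variable {b : ℕ} [Fact b.Prime] {s : ℕ}

lemma levelKernel_self (k : ℕ) (ξ : ℕ → Fin b) : levelKernel k ξ ξ = 1 := by
  have h : (level b k).card ≠ 0 := Finset.card_ne_zero_of_mem (mem_level.2 rfl : k ∈ level b k)
  simp [levelKernel, Complex.mul_conj, Complex.normSq_eq_norm_sq, norm_seqWal, h]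

lemma memLp_seqWalVec {P : Measure (Fin s → ℕ → Fin b)} [IsFiniteMeasure P] (k : Fin s → ℕ) :
    MemLp (seqWalVec k) 2 P :=
  MemLp.of_bound (measurable_seqWalVec k).aestronglyMeasurable 1
    (Filter.Eventually.of_forall fun x => (norm_seqWalVec k x).le)

/-- The Walsh functions as elements of `L²` of the digit space. -/
def walLp (b : ℕ) [Fact b.Prime] {s : ℕ} (k : Fin s → ℕ) : Lp ℂ 2 (digitMeasure b s) :=
  (memLp_seqWalVec k).toLp (seqWalVec k)

lemma inner_walLp (k : Fin s → ℕ) (F : Lp ℂ 2 (digitMeasure b s)) :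
    inner ℂ (walLp b k) F = ∫ x, F x * (starRingEnd ℂ) (seqWalVec k x) ∂(digitMeasure b s) := by
  rw [L2.inner_def]
  refine integral_congr_ae ?_
  filter_upwards [MemLp.coeFn_toLp (memLp_seqWalVec (P := digitMeasure b s) k)] with x hx
  rw [walLp, hx, RCLike.inner_apply]

section
variable {Ω : Type*} [MeasurableSpace Ω] {μ : Measure Ω}
  {perm : Fin s → List (Fin b) → Ω → Equiv.Perm (Fin b)}

/-- Composition with the scrambling of the point with digits `x`, as an isometry of `L²` spaces. -/
def scrambleIso (hperm : IsScrambling μ perm) (x : Fin s → ℕ → Fin b) :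
    Lp ℂ 2 (digitMeasure b s) →ₗᵢ[ℂ] Lp ℂ 2 μ :=
  Lp.compMeasurePreservingₗᵢ ℂ (scrambleSeq perm x) (hperm.measurePreserving_scrambleSeq x)

lemma coeFn_scrambleIso (hperm : IsScrambling μ perm) (x : Fin s → ℕ → Fin b)
    (F : Lp ℂ 2 (digitMeasure b s)) :
    scrambleIso hperm x F =ᵐ[μ] fun ω => F (scrambleSeq perm x ω) :=
  Lp.coeFn_compMeasurePreserving F (hperm.measurePreserving_scrambleSeq x)

/-- The scrambled Walsh functions inherit their inner products from the mixed moments. -/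
lemma inner_scrambleIso (hperm : IsScrambling μ perm) (x x' : Fin s → ℕ → Fin b)
    (k k' : Fin s → ℕ) :
    inner ℂ (scrambleIso hperm x (walLp b k)) (scrambleIso hperm x' (walLp b k')) =
      if k' = k then ∏ j, levelKernel (k' j) (x' j) (x j) else 0 := by
  have h : ∀ (x : Fin s → ℕ → Fin b) (k : Fin s → ℕ),
      scrambleIso hperm x (walLp b k) =ᵐ[μ] fun ω => seqWalVec k (scrambleSeq perm x ω) :=
    fun x k => (coeFn_scrambleIso hperm x _).trans
      ((hperm.measurePreserving_scrambleSeq x).quasiMeasurePreserving.ae_eq_comp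
        (MemLp.coeFn_toLp (memLp_seqWalVec k)))
  rw [← hperm.integral_seqWalVec, L2.inner_def]
  refine integral_congr_ae ?_
  filter_upwards [h x k, h x' k'] with ω h1 h2
  rw [h1, h2, RCLike.inner_apply]

/-- Orthonormality of the Walsh functions, read off from their moments under scrambling. -/
lemma IsScrambling.orthonormal_walLp (hperm : IsScrambling μ perm) :
    Orthonormal ℂ (walLp b (s := s)) := by
  classical
  rw [orthonormal_iff_ite]
  intro k k'
  rw [← (scrambleIso hperm 0).inner_map_map, inner_scrambleIso]
  simp only [levelKernel_self, Finset.prod_const_one, eq_comm]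

lemma orthogonal_span_walLp : (Submodule.span ℂ (Set.range (walLp b (s := s))))ᗮ = ⊥ := by
  rw [eq_bot_iff]
  intro F hF
  rw [Submodule.mem_orthogonal] at hF
  rw [Submodule.mem_bot, Lp.eq_zero_iff_ae_eq_zero]
  refine ae_eq_zero_of_integral_mul_conj_seqWalVec
    ((Lp.memLp F).integrable one_le_two) fun k => ?_
  rw [← inner_walLp]
  exact hF _ (Submodule.subset_span ⟨k, rfl⟩)

/-- The average of a square-integrable function over the scramblings of `x 0, …, x (N - 1)`, as an
operator between `L²` spaces. -/
def scrambleMean (hperm : IsScrambling μ perm) (N : ℕ) (x : ℕ → Fin s → ℕ → Fin b) :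
    Lp ℂ 2 (digitMeasure b s) →L[ℂ] Lp ℂ 2 μ :=
  (N : ℂ)⁻¹ • ∑ h ∈ Finset.range N, (scrambleIso hperm (x h)).toContinuousLinearMap

lemma scrambleMean_apply (hperm : IsScrambling μ perm) (N : ℕ) (x : ℕ → Fin s → ℕ → Fin b)
    (F : Lp ℂ 2 (digitMeasure b s)) :
    scrambleMean hperm N x F = (N : ℂ)⁻¹ • ∑ h ∈ Finset.range N, scrambleIso hperm (x h) F := by
  simp [scrambleMean]

lemma inner_scrambleMean_of_ne (hperm : IsScrambling μ perm) (N : ℕ) (x : ℕ → Fin s → ℕ → Fin b)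
    {k k' : Fin s → ℕ} (h : k ≠ k') :
    inner ℂ (scrambleMean hperm N x (walLp b k)) (scrambleMean hperm N x (walLp b k')) = 0 := by
  rw [scrambleMean_apply, scrambleMean_apply, inner_smul_left, inner_smul_right, sum_inner]
  simp_rw [inner_sum, inner_scrambleIso, if_neg h.symm]
  simp

/-- The second moment of the scrambled mean of a Walsh function is the average, over its level, of the
squared integration errors of the unscrambled points. -/
lemma norm_scrambleMean_sq (hperm : IsScrambling μ perm) (N : ℕ) (x : ℕ → Fin s → ℕ → Fin b)
    (k : Fin s → ℕ) :
    ‖scrambleMean hperm N x (walLp b k)‖ ^ 2 =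
      ((Fintype.piFinset fun j => level b (k j)).card : ℝ)⁻¹ *
        ∑ κ ∈ Fintype.piFinset fun j => level b (k j),
          ‖(N : ℂ)⁻¹ * ∑ h ∈ Finset.range N, seqWalVec κ (x h)‖ ^ 2 := by
  rw [← Complex.ofReal_inj]
  push_cast
  simp_rw [← Complex.mul_conj']
  have := inner_self_eq_norm_sq_to_K (𝕜 := ℂ) (scrambleMean hperm N x (walLp b k))
  rw [show ((‖scrambleMean hperm N x (walLp b k)‖ : ℝ) : ℂ) ^ 2 = _ from this.symm,
    scrambleMean_apply, inner_smul_left, inner_smul_right, sum_inner]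
  simp_rw [inner_sum, inner_scrambleIso, if_true, prod_levelKernel]
  simp_rw [map_mul, map_sum, map_inv₀, Complex.conj_natCast]
  simp_rw [← Finset.mul_sum]
  have hcomm : ∑ h ∈ Finset.range N, ∑ h' ∈ Finset.range N,
      ∑ κ ∈ Fintype.piFinset fun j => level b (k j),
        seqWalVec κ (x h') * (starRingEnd ℂ) (seqWalVec κ (x h)) =
      ∑ κ ∈ Fintype.piFinset fun j => level b (k j),
        (∑ h ∈ Finset.range N, seqWalVec κ (x h)) *
          ∑ h ∈ Finset.range N, (starRingEnd ℂ) (seqWalVec κ (x h)) := by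
    simp_rw [Finset.sum_mul_sum]
    rw [Finset.sum_comm' (s := Finset.range N) (t' := Finset.range N)
      (s' := fun _ => Finset.range N) (t := fun _ => Finset.range N) (by simp)]
    simp_rw [Finset.sum_comm (t := Fintype.piFinset fun j => level b (k j))]
  have hfac : ∑ κ ∈ Fintype.piFinset fun j => level b (k j),
      ((N : ℂ)⁻¹ * ∑ h ∈ Finset.range N, seqWalVec κ (x h)) *
        ((N : ℂ)⁻¹ * ∑ h ∈ Finset.range N, (starRingEnd ℂ) (seqWalVec κ (x h))) =
      (N : ℂ)⁻¹ * ((N : ℂ)⁻¹ * ∑ κ ∈ Fintype.piFinset fun j => level b (k j),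
        (∑ h ∈ Finset.range N, seqWalVec κ (x h)) *
          ∑ h ∈ Finset.range N, (starRingEnd ℂ) (seqWalVec κ (x h))) := by
    rw [Finset.mul_sum, Finset.mul_sum]
    exact Finset.sum_congr rfl fun κ _ => by ring
  rw [hcomm, hfac]
  ring

/-- The Walsh expansion of a square-integrable function, sent through the averaging operator, bounds
the mean square deviation of the average from the mean of the function. -/
lemma norm_scrambleMean_sub_sq_le (hperm : IsScrambling μ perm) (N : ℕ)
    (x : ℕ → Fin s → ℕ → Fin b) (F : Lp ℂ 2 (digitMeasure b s)) {C : ℝ}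
    (hC : ∀ A : Finset (Fin s → ℕ), 0 ∉ A →
      ∑ k ∈ A, ‖inner ℂ (walLp b k) F‖ ^ 2 * ‖scrambleMean hperm N x (walLp b k)‖ ^ 2 ≤ C) :
    ‖scrambleMean hperm N x (F - inner ℂ (walLp b 0) F • walLp b 0)‖ ^ 2 ≤ C := by
  classical
  let B := HilbertBasis.mkOfOrthogonalEqBot hperm.orthonormal_walLp orthogonal_span_walLp
  have hB : ∀ k, B k = walLp b k := fun k => by
    rw [HilbertBasis.coe_mkOfOrthogonalEqBot]
  let d : (Fin s → ℕ) → ℂ := fun k => if k = 0 then 0 else inner ℂ (walLp b k) F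
  have hF : HasSum (fun k => d k • walLp b k) (F - inner ℂ (walLp b 0) F • walLp b 0) := by
    have h1 := B.hasSum_repr F
    simp_rw [B.repr_apply_apply, hB] at h1
    have h2 := hasSum_ite_eq (0 : Fin s → ℕ) (inner ℂ (walLp b 0) F • walLp b (s := s) 0)
    convert! h1.sub h2 using 2 with k
    by_cases hk : k = 0
    · subst hk
      simp [d]
    · simp [d, hk]
  have hT := (scrambleMean hperm N x).hasSum hF
  refine le_of_tendsto ((hT.norm).pow 2) (Filter.Eventually.of_forall fun A => ?_)
  have hpyth : ‖∑ k ∈ A, scrambleMean hperm N x (d k • walLp b k)‖ ^ 2 =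
      ∑ k ∈ A, ‖d k‖ ^ 2 * ‖scrambleMean hperm N x (walLp b k)‖ ^ 2 := by
    rw [← Complex.ofReal_inj]
    push_cast
    refine (inner_self_eq_norm_sq_to_K (𝕜 := ℂ)
      (∑ k ∈ A, scrambleMean hperm N x (d k • walLp b k))).symm.trans ?_
    rw [sum_inner]
    refine Finset.sum_congr rfl fun k hk => ?_
    rw [inner_sum, Finset.sum_eq_single_of_mem k hk]
    · rw [map_smul]
      refine (inner_self_eq_norm_sq_to_K (𝕜 := ℂ) _).trans ?_
      rw [norm_smul]
      push_cast
      exact mul_pow _ _ _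
    · intro k' _ hne
      rw [map_smul, map_smul, inner_smul_left, inner_smul_right,
        inner_scrambleMean_of_ne hperm N x hne.symm]
      simp
  rw [hpyth]
  refine le_trans (le_of_eq ?_) (hC (A.erase 0) (Finset.notMem_erase _ _))
  rw [← Finset.sum_erase A (a := 0) (by simp [d])]
  exact Finset.sum_congr rfl fun k hk => by simp [d, Finset.ne_of_mem_erase hk]

end
end

/-! ### The coefficients of the bound -/

section
variable {b : ℕ} [Fact b.Prime] {s : ℕ}

lemma r_nonneg (a : ℝ) {γ : ℝ} (hγ : 0 < γ) (k : ℕ) : 0 ≤ r b a γ k := by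
  have : (1 : ℝ) < b := by exact_mod_cast one_lt_base (b := b)
  have h : (0 : ℝ) < (b : ℝ) - 1 := sub_pos.2 this
  unfold r
  split_ifs <;> positivity

lemma rVec_nonneg (a : ℝ) {γ : Fin s → ℝ} (hγ : ∀ j, 0 < γ j) (k : Fin s → ℕ) :
    0 ≤ rVec b a γ k :=
  Finset.prod_nonneg fun j _ => r_nonneg a (hγ j) (k j)

lemma summable_r {a : ℝ} (ha : 1 < a) {γ : ℝ} (hγ : 0 < γ) : Summable (r b a γ) := by
  have hb : (1 : ℝ) < b := by exact_mod_cast one_lt_base (b := b)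
  have h : (0 : ℝ) < (b : ℝ) - 1 := sub_pos.2 hb
  rw [← summable_nat_add_iff 1]
  have hs : Summable fun k : ℕ => γ * (b / (b - 1)) * (((k + 1 : ℕ) : ℝ) ^ a)⁻¹ :=
    (((summable_nat_add_iff 1).2 (Real.summable_nat_rpow_inv.2 ha))).mul_left _
  refine Summable.of_nonneg_of_le (fun k => r_nonneg a hγ _) (fun k => ?_) hs
  rw [r, if_neg (Nat.succ_ne_zero k), mul_assoc, div_mul_eq_div_div, div_eq_mul_inv _ (_ ^ _)]
  have h1 : ((k + 1 : ℕ) : ℝ) ^ a ≤ (b : ℝ) ^ (a * ((Nat.digits b (k + 1)).length : ℝ)) := by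
    rw [mul_comm, Real.rpow_mul (by positivity), Real.rpow_natCast]
    exact Real.rpow_le_rpow (by positivity)
      (by exact_mod_cast (lt_pow_digits_length (b := b) (k + 1)).le) (by linarith)
  gcongr

lemma summable_rVec {a : ℝ} (ha : 1 < a) {γ : Fin s → ℝ} (hγ : ∀ j, 0 < γ j) :
    Summable (rVec b a γ) := by
  classical
  refine summable_of_sum_le (c := ∏ j, ∑' k, r b a (γ j) k) (rVec_nonneg a hγ) fun A => ?_
  have hA : A ⊆ Fintype.piFinset fun j => A.image fun k => k j := fun k hk =>
    Fintype.mem_piFinset.2 fun j => Finset.mem_image_of_mem _ hk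
  refine (Finset.sum_le_sum_of_subset_of_nonneg hA fun k _ _ => rVec_nonneg a hγ k).trans ?_
  simp only [rVec]
  rw [← Finset.prod_univ_sum]
  exact Finset.prod_le_prod (fun j _ => Finset.sum_nonneg fun k _ => r_nonneg a (hγ j) k)
    fun j _ => (summable_r ha (hγ j)).sum_le_tsum _ fun k _ => r_nonneg a (hγ j) k

/-- The number of base-`b` digits of each coordinate. -/
def levelVec (b : ℕ) (k : Fin s → ℕ) : Fin s → ℕ := fun j => (Nat.digits b (k j)).length

lemma mem_piFinset_level {k κ : Fin s → ℕ} :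
    κ ∈ Fintype.piFinset (fun j => level b (k j)) ↔ levelVec b κ = levelVec b k := by
  simp only [Fintype.mem_piFinset, mem_level, funext_iff, levelVec]

lemma levelSet_levelVec {b s : ℕ} (k : Fin s → ℕ) :
    levelSet b (Finset.univ.filter fun j => k j ≠ 0) (levelVec b k) =
      Fintype.piFinset fun j => level b (k j) := by
  unfold levelSet level levelVec
  congr 1
  funext j
  by_cases h : k j = 0 <;> simp [h]

lemma card_level_mul_r (α γ : ℝ) {k κ : ℕ} (h : κ ∈ level b k) :
    ((level b k).card : ℝ) * r b (2 * α + 1) γ κ =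
      if k = 0 then 1 else γ * (b : ℝ) ^ (-(2 * α) * ((Nat.digits b k).length : ℝ)) := by
  have hlen := mem_level.1 h
  have hb : (1 : ℝ) < b := by exact_mod_cast one_lt_base (b := b)
  have hb1 : (b : ℝ) - 1 ≠ 0 := (sub_pos.2 hb).ne'
  have hb0 : (0 : ℝ) < b := by linarith
  by_cases hk : k = 0
  · subst hk
    have : κ = 0 := by simpa [level] using h
    simp [level, r, this]
  · have hκ : κ ≠ 0 := by
      rintro rfl
      exact hk (length_digits_eq_zero.1 (hlen.symm.trans (by simp)))
    obtain ⟨l, hl⟩ : ∃ l, (Nat.digits b k).length = l + 1 :=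
       Nat.exists_eq_succ_of_ne_zero (length_digits_eq_zero.not.2 hk)
    have hle : b ^ l ≤ b ^ (l + 1) := Nat.pow_le_pow_right (NeZero.pos b) (Nat.le_succ l)
    rw [r, if_neg hκ, if_neg hk, hlen, level, if_neg hk, hl, Nat.card_Ico, Nat.add_sub_cancel,
      Nat.cast_sub hle]
    have h1 : (2 * α + 1) * ((l + 1 : ℕ) : ℝ) = 2 * α * ((l + 1 : ℕ) : ℝ) + ((l + 1 : ℕ) : ℝ) := by
      ring
    rw [h1, Real.rpow_add hb0, Real.rpow_natCast, neg_mul, Real.rpow_neg hb0.le]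
    have h2 : (b : ℝ) ^ (2 * α * ((l + 1 : ℕ) : ℝ)) ≠ 0 := (Real.rpow_pos_of_pos hb0 _).ne'
    push_cast at h2 ⊢
    field_simp
    ring

lemma card_piFinset_level_mul_rVec (α : ℝ) (γ : Fin s → ℝ) {k κ : Fin s → ℕ}
    (h : κ ∈ Fintype.piFinset fun j => level b (k j)) :
    ((Fintype.piFinset fun j => level b (k j)).card : ℝ) * rVec b (2 * α + 1) γ κ =
      (∏ j ∈ Finset.univ.filter fun j => k j ≠ 0, γ j) *
        (b : ℝ) ^ (-(2 * α) *
          ((∑ j ∈ Finset.univ.filter fun j => k j ≠ 0, levelVec b k j : ℕ) : ℝ)) := by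
  have hb0 : (0 : ℝ) < b := by exact_mod_cast NeZero.pos b
  rw [Fintype.card_piFinset, rVec, Nat.cast_prod, ← Finset.prod_mul_distrib,
    Finset.prod_congr rfl fun j _ => card_level_mul_r α (γ j) (Fintype.mem_piFinset.1 h j)]
  push_cast
  rw [Finset.mul_sum, Real.rpow_sum_of_pos hb0, ← Finset.prod_mul_distrib, Finset.prod_filter]
  refine Finset.prod_congr rfl fun j _ => ?_
  by_cases hj : k j = 0 <;> simp [hj, levelVec]

/-- On the unit ball of the weighted space, the Walsh coefficients on the level of `k` are controlled
by the value of `r` on that level. -/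
lemma sum_walshCoeff_sq_le {α : ℝ} {γ : Fin s → ℝ} (hγ : ∀ j, 0 < γ j)
    {f : (Fin s → ℝ) → ℝ} (hf : weightedNorm b α γ f ≤ 1) (k : Fin s → ℕ) :
    ∑ κ ∈ Fintype.piFinset fun j => level b (k j), ‖walshCoeff b f κ‖ ^ 2 ≤
      ((Fintype.piFinset fun j => level b (k j)).card : ℝ) * rVec b (2 * α + 1) γ k := by
  have hb0 : (0 : ℝ) < b := by exact_mod_cast NeZero.pos b
  rw [card_piFinset_level_mul_rVec α γ (mem_piFinset_level.2 rfl)]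
  set u := Finset.univ.filter fun j => k j ≠ 0 with hu
  have hl : ∀ i ∈ u, 1 ≤ levelVec b k i := by
    intro i hi
    have : k i ≠ 0 := (Finset.mem_filter.1 hi).2
    exact Nat.one_le_iff_ne_zero.2 (length_digits_eq_zero.not.2 this)
  have h1 : ENNReal.ofReal ((∏ j ∈ u, γ j) ^ (-(1 / 2) : ℝ) *
      ((b : ℝ) ^ (α * ((∑ i ∈ u, levelVec b k i : ℕ) : ℝ)) * sigma b f u (levelVec b k))) ≤ 1 := by
    refine le_trans ?_ hf
    unfold weightedNorm
    exact le_iSup_of_le u (le_iSup_of_le (levelVec b k) (le_iSup_of_le hl le_rfl))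
  rw [ENNReal.ofReal_le_one] at h1
  have hP : 0 < ∏ j ∈ u, γ j := Finset.prod_pos fun j _ => hγ j
  set P := ∏ j ∈ u, γ j
  set S := ((∑ i ∈ u, levelVec b k i : ℕ) : ℝ)
  have hσ0 : 0 ≤ sigma b f u (levelVec b k) := Real.sqrt_nonneg _
  have h2 : (P ^ (-(1 / 2) : ℝ) * ((b : ℝ) ^ (α * S) * sigma b f u (levelVec b k))) ^ 2 ≤ 1 :=
    pow_le_one₀ (by positivity) h1
  have h3 : sigma b f u (levelVec b k) ^ 2 =
      ∑ κ ∈ Fintype.piFinset fun j => level b (k j), ‖walshCoeff b f κ‖ ^ 2 := by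
    rw [sigma, Real.sq_sqrt (Finset.sum_nonneg fun κ _ => sq_nonneg _), hu, levelSet_levelVec]
  have h4 : (P ^ (-(1 / 2) : ℝ)) ^ 2 = P⁻¹ := by
    rw [← Real.rpow_natCast, ← Real.rpow_mul hP.le]
    norm_num [Real.rpow_neg_one]
  have h5 : ((b : ℝ) ^ (α * S)) ^ 2 = ((b : ℝ) ^ (-(2 * α) * S))⁻¹ := by
    rw [← Real.rpow_natCast, ← Real.rpow_mul hb0.le, ← Real.rpow_neg hb0.le]
    congr 1
    push_cast
    ring
  rw [mul_pow, mul_pow, h3, h4, h5, ← mul_assoc, ← mul_inv, inv_mul_le_one₀ (by positivity)] at h2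
  exact h2

/-- If `t k` is at most the proportion of elements of `D` in the level of `k`, then the sum of
`|f̂(k)|² t k` over nonzero `k` is at most the sum of `r` over `D \ {0}`. This is seen level by level:
the `|f̂(k)|²` of a level add up to at most its number of elements times the constant value of `r` on
it, and multiplying this by the proportion leaves one summand `r` for each element of `D`. -/
lemma sum_le_tsum_dual {α : ℝ} (hα : 0 < α) {γ : Fin s → ℝ} (hγ : ∀ j, 0 < γ j)
    {f : (Fin s → ℝ) → ℝ} (hf : weightedNorm b α γ f ≤ 1) (D : Set (Fin s → ℕ))
    (t : (Fin s → ℕ) → ℝ)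
    (ht : ∀ k, t k ≤ ((Fintype.piFinset fun j => level b (k j)).card : ℝ)⁻¹ *
      ∑ κ ∈ Fintype.piFinset fun j => level b (k j), D.indicator (fun _ => (1 : ℝ)) κ)
    (A : Finset (Fin s → ℕ)) (hA : 0 ∉ A) :
    ∑ k ∈ A, ‖walshCoeff b f k‖ ^ 2 * t k ≤ ∑' k : ↥(D \ {0}), rVec b (2 * α + 1) γ k := by
  classical
  have hsum : Summable (rVec b (2 * α + 1) γ) := summable_rVec (by linarith) hγ
  let L : (Fin s → ℕ) → Finset (Fin s → ℕ) := fun k => Fintype.piFinset fun j => level b (k j)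
  have hL : ∀ k κ, κ ∈ L k ↔ levelVec b κ = levelVec b k := fun k κ => mem_piFinset_level
  let E := A.biUnion L
  have hmaps : ∀ κ ∈ E, levelVec b κ ∈ A.image (levelVec b) := by
    intro κ hκ
    obtain ⟨k, hk, hκk⟩ := Finset.mem_biUnion.1 hκ
    exact Finset.mem_image.2 ⟨k, hk, ((hL k κ).1 hκk).symm⟩
  rw [tsum_subtype (D \ {0}) (rVec b (2 * α + 1) γ)]
  have hE : ∑ κ ∈ E, (D \ {0}).indicator (rVec b (2 * α + 1) γ) κ ≤
      ∑' κ, (D \ {0}).indicator (rVec b (2 * α + 1) γ) κ :=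
    (hsum.indicator _).sum_le_tsum _ fun κ _ =>
      Set.indicator_nonneg (fun κ _ => rVec_nonneg _ hγ κ) κ
  refine le_trans ?_ hE
  rw [← Finset.sum_fiberwise_of_maps_to hmaps,
    ← Finset.sum_fiberwise_of_maps_to (t := A.image (levelVec b))
      (fun k hk => Finset.mem_image_of_mem _ hk)]
  refine Finset.sum_le_sum fun v hv => ?_
  obtain ⟨k, hk, rfl⟩ := Finset.mem_image.1 hv
  have hk0 : k ≠ 0 := fun h => hA (h ▸ hk)
  have hcard : (0 : ℝ) < (L k).card := by
    exact_mod_cast Finset.card_pos.2 ⟨k, (hL k k).2 rfl⟩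
  have hEk : E.filter (fun κ => levelVec b κ = levelVec b k) = L k := by
    ext κ
    rw [Finset.mem_filter, hL]
    exact ⟨fun h => h.2, fun h => ⟨Finset.mem_biUnion.2 ⟨k, hk, (hL k κ).2 h⟩, h⟩⟩
  have hr : ∀ κ ∈ L k, rVec b (2 * α + 1) γ κ = rVec b (2 * α + 1) γ k := by
    intro κ hκ
    refine mul_left_cancel₀ hcard.ne' ?_
    rw [card_piFinset_level_mul_rVec α γ hκ, card_piFinset_level_mul_rVec α γ ((hL k k).2 rfl)]
  have hzero : (0 : Fin s → ℕ) ∉ L k := by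
    intro h
    refine hk0 (funext fun j => ?_)
    have := congrFun ((hL k 0).1 h) j
    exact length_digits_eq_zero.1 (this.symm.trans (by simp [levelVec]))
  have hD0 : 0 ≤ ∑ κ ∈ L k, D.indicator (fun _ => (1 : ℝ)) κ :=
    Finset.sum_nonneg fun κ _ => Set.indicator_nonneg (fun _ _ => zero_le_one) κ
  rw [hEk]
  calc ∑ κ ∈ A.filter (fun κ => levelVec b κ = levelVec b k), ‖walshCoeff b f κ‖ ^ 2 * t κ
      ≤ ∑ κ ∈ A.filter (fun κ => levelVec b κ = levelVec b k), ‖walshCoeff b f κ‖ ^ 2 *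
          (((L k).card : ℝ)⁻¹ * ∑ κ ∈ L k, D.indicator (fun _ => (1 : ℝ)) κ) := by
        refine Finset.sum_le_sum fun κ hκ => mul_le_mul_of_nonneg_left ?_ (sq_nonneg _)
        have : L κ = L k := by
          ext κ'
          rw [hL, hL, (Finset.mem_filter.1 hκ).2]
        rw [← this]
        exact ht κ
    _ ≤ (∑ κ ∈ L k, ‖walshCoeff b f κ‖ ^ 2) *
          (((L k).card : ℝ)⁻¹ * ∑ κ ∈ L k, D.indicator (fun _ => (1 : ℝ)) κ) := by
        rw [← Finset.sum_mul]
        refine mul_le_mul_of_nonneg_right ?_ (by positivity)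
        refine Finset.sum_le_sum_of_subset_of_nonneg ?_ fun _ _ _ => sq_nonneg _
        exact fun κ hκ => (hL k κ).2 (Finset.mem_filter.1 hκ).2
    _ ≤ (((L k).card : ℝ) * rVec b (2 * α + 1) γ k) *
          (((L k).card : ℝ)⁻¹ * ∑ κ ∈ L k, D.indicator (fun _ => (1 : ℝ)) κ) :=
        mul_le_mul_of_nonneg_right (sum_walshCoeff_sq_le hγ hf k) (by positivity)
    _ = ∑ κ ∈ L k, rVec b (2 * α + 1) γ k * D.indicator (fun _ => (1 : ℝ)) κ := by
        rw [← Finset.mul_sum]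
        field_simp
    _ = ∑ κ ∈ L k, (D \ {0}).indicator (rVec b (2 * α + 1) γ) κ := by
        refine Finset.sum_congr rfl fun κ hκ => ?_
        have h0 : κ ≠ 0 := fun h => hzero (h ▸ hκ)
        by_cases hD : κ ∈ D
        · rw [Set.indicator_of_mem hD, Set.indicator_of_mem (Set.mem_sdiff_singleton.2 ⟨hD, h0⟩),
            hr κ hκ, mul_one]
        · rw [Set.indicator_of_notMem hD, Set.indicator_of_notMem fun h => hD h.1, mul_zero]

end

/-! ### The variance of the scrambled estimator -/

section
variable {b : ℕ} [Fact b.Prime] {s : ℕ}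

lemma memLp_comp_digitPoint {f : (Fin s → ℝ) → ℝ} (hf : MemLp f 2 (cubeMeasure s)) :
    MemLp (fun x => (f (digitPoint x) : ℂ)) 2 (digitMeasure b s) :=
  (hf.comp_measurePreserving measurePreserving_digitPoint).ofReal

/-- A square-integrable function on the cube as a complex-valued function of the digits. -/
def digitLp (b : ℕ) [Fact b.Prime] {f : (Fin s → ℝ) → ℝ} (hf : MemLp f 2 (cubeMeasure s)) :
    Lp ℂ 2 (digitMeasure b s) :=
  (memLp_comp_digitPoint hf).toLp _

lemma inner_walLp_digitLp {f : (Fin s → ℝ) → ℝ} (hf : MemLp f 2 (cubeMeasure s))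
    (k : Fin s → ℕ) : inner ℂ (walLp b k) (digitLp b hf) = walshCoeff b f k := by
  have h1 : inner ℂ (walLp b k) (digitLp b hf) =
      ∫ x, (f (digitPoint x) : ℂ) * (starRingEnd ℂ) (seqWalVec k x) ∂(digitMeasure b s) := by
    rw [inner_walLp]
    refine integral_congr_ae ?_
    filter_upwards [MemLp.coeFn_toLp (memLp_comp_digitPoint (b := b) hf)] with x hx
    rw [digitLp, hx]
  have hint : Integrable (fun x => (f (digitPoint x) : ℂ) * (starRingEnd ℂ) (seqWalVec k x))
      (digitMeasure b s) :=
    integrable_mul_conj_seqWalVec ((memLp_comp_digitPoint hf).integrable one_le_two) k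
  rw [h1, digitMeasure, integral_map measurable_digitMap.aemeasurable hint.aestronglyMeasurable,
    walshCoeff]
  refine integral_congr_ae ?_
  filter_upwards [digitPoint_digitMap_ae (b := b)] with x hx
  rw [hx, id, walVec_eq]

lemma estimator_eq {Ω : Type*} {perm : Fin s → List (Fin b) → Ω → Equiv.Perm (Fin b)}
    (N : ℕ) (z : ℕ → Fin s → ℝ) (f : (Fin s → ℝ) → ℝ) (ω : Ω) :
    estimator perm N z f ω = (N : ℝ)⁻¹ *
      ∑ h ∈ Finset.range N, f (digitPoint (scrambleSeq perm (digitMap b (z h)) ω)) := by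
  rw [estimator, one_div]
  rfl

variable {Ω : Type*} [MeasurableSpace Ω] {μ : Measure Ω}
  {perm : Fin s → List (Fin b) → Ω → Equiv.Perm (Fin b)}

lemma IsScrambling.memLp_estimator (hperm : IsScrambling μ perm) (N : ℕ) (z : ℕ → Fin s → ℝ)
    {f : (Fin s → ℝ) → ℝ} (hf : MemLp f 2 (cubeMeasure s)) :
    MemLp (estimator perm N z f) 2 μ := by
  rw [funext (estimator_eq N z f)]
  have hsum := memLp_finsetSum (μ := μ) (p := 2) (Finset.range N)
    (f := fun h ω => f (digitPoint (scrambleSeq perm (digitMap b (z h)) ω))) fun h _ =>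
      hf.comp_measurePreserving
        (measurePreserving_digitPoint.comp (hperm.measurePreserving_scrambleSeq (digitMap b (z h))))
  exact hsum.const_mul _

lemma scrambleMean_toLp (hperm : IsScrambling μ perm) (N : ℕ) (x : ℕ → Fin s → ℕ → Fin b)
    {g : (Fin s → ℕ → Fin b) → ℂ} (hg : MemLp g 2 (digitMeasure b s)) :
    scrambleMean hperm N x (hg.toLp g) =ᵐ[μ] fun ω =>
      (N : ℂ)⁻¹ * ∑ h ∈ Finset.range N, g (scrambleSeq perm (x h) ω) := by
  have h : ∀ h, scrambleIso hperm (x h) (hg.toLp g) =ᵐ[μ] fun ω => g (scrambleSeq perm (x h) ω) :=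
    fun h => (coeFn_scrambleIso hperm (x h) _).trans
      ((hperm.measurePreserving_scrambleSeq (x h)).quasiMeasurePreserving.ae_eq_comp
        (MemLp.coeFn_toLp hg))
  rw [scrambleMean_apply]
  have hall : ∀ᵐ ω ∂μ, ∀ i, scrambleIso hperm (x i) (hg.toLp g) ω = g (scrambleSeq perm (x i) ω) :=
    ae_all_iff.2 h
  filter_upwards [Lp.coeFn_smul (N : ℂ)⁻¹
      (∑ h ∈ Finset.range N, scrambleIso hperm (x h) (hg.toLp g)),
    Lp.coeFn_finsetSum (Finset.range N) (fun h => scrambleIso hperm (x h) (hg.toLp g)), hall]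
    with ω h1 h2 h3
  rw [h1, Pi.smul_apply, h2, Finset.sum_apply, smul_eq_mul]
  simp_rw [h3]

/-- The variance is at most the mean square deviation from the integral of `f`, the zeroth Walsh
coefficient. -/
lemma IsScrambling.evariance_estimator_le (hperm : IsScrambling μ perm) {N : ℕ} (hN : N ≠ 0)
    (z : ℕ → Fin s → ℝ) {f : (Fin s → ℝ) → ℝ} (hf : MemLp f 2 (cubeMeasure s)) :
    evariance (estimator perm N z f) μ ≤ ENNReal.ofReal
      (‖scrambleMean hperm N (fun h => digitMap b (z h))
        (digitLp b hf - inner ℂ (walLp b 0) (digitLp b hf) • walLp b 0)‖ ^ 2) := by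
  have := hperm.indep.isProbabilityMeasure
  have hX := hperm.memLp_estimator N z hf
  set X := estimator perm N z f
  set G := scrambleMean hperm N (fun h => digitMap b (z h))
        (digitLp b hf - inner ℂ (walLp b 0) (digitLp b hf) • walLp b 0) with hG
  let a : ℝ := ∫ x, f x ∂(cubeMeasure s)
  have ha : inner ℂ (walLp b 0) (digitLp b hf) = (a : ℂ) := by
    rw [inner_walLp_digitLp, walshCoeff]
    simp_rw [walVec_eq, seqWalVec_zero, map_one, mul_one]
    exact integral_ofReal
  have hGX : G =ᵐ[μ] fun ω => ((X ω - a : ℝ) : ℂ) := by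
    rw [hG, map_sub, map_smul, ha]
    filter_upwards [Lp.coeFn_sub (scrambleMean hperm N (fun h => digitMap b (z h)) (digitLp b hf))
        ((a : ℂ) • scrambleMean hperm N (fun h => digitMap b (z h)) (walLp b 0)),
      Lp.coeFn_smul (a : ℂ) (scrambleMean hperm N (fun h => digitMap b (z h)) (walLp b 0)),
      scrambleMean_toLp hperm N (fun h => digitMap b (z h)) (memLp_comp_digitPoint (b := b) hf),
      scrambleMean_toLp hperm N (fun h => digitMap b (z h))
        (memLp_seqWalVec (b := b) (s := s) 0)] with ω h1 h2 h3 h4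
    rw [h1, Pi.sub_apply, h2, Pi.smul_apply, digitLp, h3, walLp, h4]
    have hN' : (N : ℂ) ≠ 0 := Nat.cast_ne_zero.2 hN
    simp only [X, estimator_eq, seqWalVec_zero, Finset.sum_const, Finset.card_range, nsmul_eq_mul,
      mul_one, inv_mul_cancel₀ hN', smul_eq_mul]
    push_cast
    rfl
  have hnorm : ‖G‖ ^ 2 = ∫ ω, (X ω - a) ^ 2 ∂μ := by
    rw [← Complex.ofReal_inj, ← integral_complex_ofReal]
    push_cast
    refine (inner_self_eq_norm_sq_to_K (𝕜 := ℂ) G).symm.trans ?_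
    rw [L2.inner_def]
    refine integral_congr_ae ?_
    filter_upwards [hGX] with ω h
    rw [h, RCLike.inner_apply, Complex.conj_ofReal, sq]
    push_cast
    rfl
  rw [← ofReal_variance hX, ← variance_sub_const hX.aestronglyMeasurable a, hnorm]
  exact ENNReal.ofReal_le_ofReal
    (variance_le_expectation_sq (hX.aestronglyMeasurable.sub aestronglyMeasurable_const))

/-- For a polynomial lattice, the factor with which `|f̂(k)|²` enters the variance is at most the
proportion of dual lattice elements in the level of `k`. -/
lemma norm_scrambleMean_latticePoint_sq_le (hperm : IsScrambling μ perm) {m : ℕ}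
    {p : (ZMod b)[X]} (hp : p.degree = m) (q : Fin s → (ZMod b)[X]) (k : Fin s → ℕ) :
    ‖scrambleMean hperm (b ^ m) (fun h => digitMap b (latticePoint m p q h)) (walLp b k)‖ ^ 2 ≤
      ((Fintype.piFinset fun j => level b (k j)).card : ℝ)⁻¹ *
        ∑ κ ∈ Fintype.piFinset fun j => level b (k j),
          (dualLattice m p q).indicator (fun _ => (1 : ℝ)) κ := by
  rw [norm_scrambleMean_sq]
  refine mul_le_mul_of_nonneg_left (Finset.sum_le_sum fun κ _ => ?_) (by positivity)
  by_cases hκ : κ ∈ dualLattice m p q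
  · rw [Set.indicator_of_mem hκ]
    refine pow_le_one₀ (norm_nonneg _) ?_
    have hle : ‖∑ h ∈ Finset.range (b ^ m), seqWalVec κ (digitMap b (latticePoint m p q h))‖ ≤
        ((b ^ m : ℕ) : ℝ) := by
      refine (norm_sum_le _ _).trans ?_
      simp [norm_seqWalVec]
    rw [norm_mul, norm_inv, Complex.norm_natCast]
    exact inv_mul_le_one_of_le₀ hle (Nat.cast_nonneg _)
  · rw [Set.indicator_of_notMem hκ, sum_seqWalVec_latticePoint hp q hκ]
    simp

end

end ScrambledPolyLattice

end

theorem corollary3p1 {b s : ℕ} [Fact b.Prime] (m : ℕ) (p : Polynomial (ZMod b))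
    (hp : p.degree = m) (q : Fin s → Polynomial (ZMod b))
    (α : ℝ) (hα0 : 0 < α) (hα1 : α ≤ 1) (γ : Fin s → ℝ) (hγ : ∀ j, 0 < γ j)
    {Ω : Type*} [MeasurableSpace Ω] (μ : Measure Ω) [IsProbabilityMeasure μ]
    (perm : Fin s → List (Fin b) → Ω → Equiv.Perm (Fin b))
    (hperm : ScrambledPolyLattice.IsScrambling μ perm) :
    Summable (fun k : ↥(ScrambledPolyLattice.dualLattice m p q \ {0}) =>
      ScrambledPolyLattice.rVec b (2 * α + 1) γ k) ∧
    ScrambledPolyLattice.worstCaseVariance μ perm (b ^ m)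
        (ScrambledPolyLattice.latticePoint m p q) α γ ≤
      ENNReal.ofReal (∑' k : ↥(ScrambledPolyLattice.dualLattice m p q \ {0}),
        ScrambledPolyLattice.rVec b (2 * α + 1) γ k) := by
  refine ⟨(ScrambledPolyLattice.summable_rVec (by linarith) hγ).subtype _, ?_⟩
  refine iSup₂_le fun f hf => iSup_le fun hf1 => ?_
  refine (hperm.evariance_estimator_le (pow_ne_zero m (NeZero.ne b)) _ hf.1).trans
    (ENNReal.ofReal_le_ofReal ?_)
  refine ScrambledPolyLattice.norm_scrambleMean_sub_sq_le hperm _ _ _ fun A hA => ?_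
  simp_rw [ScrambledPolyLattice.inner_walLp_digitLp]
  exact ScrambledPolyLattice.sum_le_tsum_dual hα0 hγ hf1 _ _
    (ScrambledPolyLattice.norm_scrambleMean_latticePoint_sq_le hperm hp q) A hA
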